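/- Let $1\le r<\infty$ and let $m\ge 2$ be an integer. Let $X=(X_i)_{i\ge1}$ and $Y=(Y_i)_{i\ge1}$ be two independent sequences of iid random variables with values in a finite alphabet $\mathcal A_m=\{\alpha_1,\dots,\alpha_m\}$, with $\mathbb P(X_1=\alpha_k)=\mathbb P(Y_1=\alpha_k)=p_k$ for $k=1,\dots,m$. For $n\ge1$ let $LC_n$ be the length of the longest common subsequence of the words $X_1\cdots X_n$ and $Y_1\cdots Y_n$, i.e. the largest $k$ such that there exist $1\le i_1<\dots<i_k\le n$ and $1\le j_1<\dots<j_k\le n$ with $X_{i_s}=Y_{j_s}$ for $s=1,\dots,k$. Put $$K=\min\left(2^{-4}\,10^{-2}\,e^{-67},\ \frac{1}{800\,m}\right),$$ and suppose that for some $j_0\in\{1,\dots,m\}$ $$\frac12<p_{j_0}<1\qquad\text{and}\qquad \max_{j\ne j_0}p_j\le\min\left(\frac{2^{-2}e^{-5}K}{m},\ \frac{K}{2m^2}\right).$$ Then there is a constant $C>0$, depending only on $r$, $m$, $p_{j_0}$ and $\max_{j\ne j_0}p_j$, such that for all $n\ge1$ $$\mathbb E\left|LC_n-\mathbb E\,LC_n\right|^r\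 \ge\ C\,n^{r/2}.$$ -/

import Mathlib

namespace LCS

/-- The words `x` and `y` have a common subsequence of length `k`. -/
def HasCommonSubseq {α : Type*} {n : ℕ} (x y : Fin n → α) (k : ℕ) : Prop :=
  ∃ i j : Fin k → Fin n, StrictMono i ∧ StrictMono j ∧ ∀ s, x (i s) = y (j s)

/-- Length of the longest common subsequence of two words of length `n`. -/
noncomputable def lcsLength {α : Type*} {n : ℕ} (x y : Fin n → α) : ℕ :=
  sSup {k : ℕ | HasCommonSubseq x y k}

/-- The supremum defining `lcsLength` is a maximum. -/
theorem isGreatest_lcsLength {α : Type*} {n : ℕ} (x y : Fin n → α) :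
    IsGreatest {k : ℕ | HasCommonSubseq x y k} (lcsLength x y) := by
  have hne : {k : ℕ | HasCommonSubseq x y k}.Nonempty :=
    ⟨0, Fin.elim0, Fin.elim0, fun a => a.elim0, fun a => a.elim0, fun a => a.elim0⟩
  have hbd : BddAbove {k : ℕ | HasCommonSubseq x y k} := by
    refine ⟨n, ?_⟩
    rintro k ⟨i, -, hi, -, -⟩
    simpa using Fintype.card_le_of_injective i hi.injective
  exact ⟨Nat.sSup_mem hne hbd, fun k hk => le_csSup hbd hk⟩

/-- The random variable `LC_n`: the length of the longest common subsequence of the words formed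
by the first `n` letters of the sequences `X` and `Y` (indexed from `0`). -/
noncomputable def LC {Ω α : Type*} (X Y : ℕ → Ω → α) (n : ℕ) (ω : Ω) : ℝ :=
  (lcsLength (fun i : Fin n => X i ω) (fun i : Fin n => Y i ω) : ℝ)

/-- The `r`-th absolute central moment `E |Z - E Z| ^ r`. -/
noncomputable def absCentralMoment {Ω : Type*} [MeasurableSpace Ω] (μ : MeasureTheory.Measure Ω)
    (Z : Ω → ℝ) (r : ℝ) : ℝ :=
  ∫ ω, |Z ω - ∫ ω', Z ω' ∂μ| ^ r ∂μ

/-- `X` and `Y` are two independent sequences of iid random variables with values in an `m`-letter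
alphabet, every letter `k` having probability `p k`. -/
structure IsIIDPair {Ω : Type*} [MeasurableSpace Ω] (μ : MeasureTheory.Measure Ω) {m : ℕ}
    (p : Fin m → ℝ) (X Y : ℕ → Ω → Fin m) : Prop where
  measurable_X : ∀ i, Measurable (X i)
  measurable_Y : ∀ i, Measurable (Y i)
  indep_X : ProbabilityTheory.iIndepFun X μ
  indep_Y : ProbabilityTheory.iIndepFun Y μ
  indep_XY : ProbabilityTheory.IndepFun (fun ω i => X i ω) (fun ω i => Y i ω) μ
  law_X : ∀ i k, μ.real (X i ⁻¹' {k}) = p k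
  law_Y : ∀ i k, μ.real (Y i ⁻¹' {k}) = p k

/-- The constant `K = min (2⁻⁴ 10⁻² e⁻⁶⁷, 1 / (800 m))`. -/
noncomputable def K (m : ℕ) : ℝ :=
  min ((2 : ℝ)⁻¹ ^ 4 * (10 : ℝ)⁻¹ ^ 2 * Real.exp (-67)) (1 / (800 * (m : ℝ)))

end LCS

/-! Write `o` for the dominant letter, call the other letters rare, let T be the number of rare
letters among the 2n letters, and let f be the length of the longest common subsequence as a
function of these letters. The proof has two halves.

Fluctuations from drift. Suppose that the sum of the changes of f over all single replacements of a
rare letter by `o` is at least c n with high probability. Resampling one coordinate gives a discrete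
integration by parts (`mean_changeSum`). Tested against a bump function of T of width of order √n
around E T, it bounds c n by O(√n) E|f - E f| (`le_mean_abs_sub`). Jensen's inequality then gives
every exponent r ≥ 1.

Drift. Cut an optimal alignment at its matched rare letters; inside the pieces only letters `o` are
matched. Replacing a rare letter in the side of a piece that has fewer letters `o` gains one, and
replacing a matched rare letter loses at most one. Optimality bounds the number of unmatched letters
`o` by twice the number of cells plus the imbalance of the two words. Hence, if the drift and the
imbalance are small, the number of gaining letters plus the number of unmatched `o` is at most 4 per
cell up to a small error (`exists_alignment_of_flipSum_le`).

Such alignments are rare by a generating function estimate. Each gaining letter and each unmatched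
`o` is weighted by τ < 1, each cell by τ⁻⁴, and every letter probability is inflated by 1 + q²/1000.
The sum over all alignments of all lengths still converges (`tsum_alignmentWt_le`), so the inflation
factor to the power 2n beats the error and the bad words have exponentially small probability.
Convergence rests on cutting optimal alignments as finely as possible: a piece with equally many `o`
on both sides contains no rare match that costs nothing. Forbidding three such patterns in every two
consecutive runs bounds the balanced pieces by about 2/(3s), where s is the sum of the squared rare
probabilities. A cell then costs about 2/3 < 1. Forbidding only the matches in equally numbered runs
would give the critical value 1. -/

namespace LCS

/-! ### Common subsequences as common sublists, and alignments -/

section Lists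

variable {A : Type*}

/-- The lists `x` and `y` have a common sublist of length `k`. -/
def CommonSublist (x y : List A) (k : ℕ) : Prop :=
  ∃ l : List A, l.Sublist x ∧ l.Sublist y ∧ l.length = k

theorem CommonSublist.append {x y x' y' : List A} {k k' : ℕ} (h : CommonSublist x y k)
    (h' : CommonSublist x' y' k') : CommonSublist (x ++ x') (y ++ y') (k + k') := by
  obtain ⟨l, h1, h2, h3⟩ := h
  obtain ⟨l', h1', h2', h3'⟩ := h'
  exact ⟨l ++ l', h1.append h1', h2.append h2', by simp [h3, h3']⟩

theorem CommonSublist.symm {x y : List A} {k : ℕ} (h : CommonSublist x y k) :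
    CommonSublist y x k := by
  obtain ⟨l, h1, h2, h3⟩ := h
  exact ⟨l, h2, h1, h3⟩

theorem commonSublist_nil (x y : List A) : CommonSublist x y 0 :=
  ⟨[], by simp, by simp, rfl⟩

theorem CommonSublist.cons {x y : List A} {k : ℕ} (a : A) (h : CommonSublist x y k) :
    CommonSublist (a :: x) (a :: y) (k + 1) := by
  obtain ⟨l, h1, h2, h3⟩ := h
  exact ⟨a :: l, by simpa using h1, by simpa using h2, by simp [h3]⟩

theorem CommonSublist.cons_right {x y : List A} {k : ℕ} (a b : A) (h : CommonSublist x y k) :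
    CommonSublist (a :: x) (b :: y) k := by
  obtain ⟨l, h1, h2, h3⟩ := h
  exact ⟨l, h1.cons a, h2.cons b, h3⟩

/-- The length of the longest common sublist. -/
noncomputable def listLcs (x y : List A) : ℕ := sSup {k | CommonSublist x y k}

theorem isGreatest_listLcs (x y : List A) :
    IsGreatest {k | CommonSublist x y k} (listLcs x y) := by
  have hbd : BddAbove {k | CommonSublist x y k} := by
    refine ⟨x.length, ?_⟩
    rintro k ⟨l, h, -, rfl⟩
    exact h.length_le
  exact ⟨Nat.sSup_mem ⟨0, commonSublist_nil x y⟩ hbd, fun k hk => le_csSup hbd hk⟩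

theorem CommonSublist.le_listLcs {x y : List A} {k : ℕ} (h : CommonSublist x y k) :
    k ≤ listLcs x y := (isGreatest_listLcs x y).2 h

theorem commonSublist_listLcs (x y : List A) : CommonSublist x y (listLcs x y) :=
  (isGreatest_listLcs x y).1

theorem listLcs_comm (x y : List A) : listLcs x y = listLcs y x :=
  le_antisymm (commonSublist_listLcs x y).symm.le_listLcs
    (commonSublist_listLcs y x).symm.le_listLcs

theorem hasCommonSubseq_iff {n : ℕ} (x y : Fin n → A) (k : ℕ) :
    HasCommonSubseq x y k ↔ CommonSublist (List.ofFn x) (List.ofFn y) k := by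
  have key : ∀ (x : Fin n → A) (l : List A), l.Sublist (List.ofFn x) ↔
      ∃ i : Fin l.length → Fin n, StrictMono i ∧ ∀ s, l.get s = x (i s) := by
    intro x l
    rw [List.sublist_iff_exists_fin_orderEmbedding_get_eq]
    constructor
    · rintro ⟨f, hf⟩
      refine ⟨fun s => Fin.cast (by simp) (f s), fun a b hab => ?_, fun s => ?_⟩
      · exact f.strictMono hab
      · rw [hf]; simp only [List.get_ofFn]
    · rintro ⟨i, hi, h⟩
      refine ⟨OrderEmbedding.ofStrictMono (fun s => Fin.cast (by simp) (i s))
        (fun a b hab => hi hab), fun s => ?_⟩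
      rw [h]; simp only [List.get_ofFn]; rfl
  constructor
  · rintro ⟨i, j, hi, hj, h⟩
    refine ⟨List.ofFn (fun s => x (i s)), (key x _).2 ⟨fun s => i (Fin.cast (by simp) s), ?_, ?_⟩,
      (key y _).2 ⟨fun s => j (Fin.cast (by simp) s), ?_, ?_⟩, by simp⟩
    · exact fun a b hab => hi hab
    · intro s; simp only [List.get_ofFn]
    · exact fun a b hab => hj hab
    · intro s; simp only [List.get_ofFn, h]
  · rintro ⟨l, hx, hy, rfl⟩
    obtain ⟨i, hi, h⟩ := (key x l).1 hx
    obtain ⟨j, hj, h'⟩ := (key y l).1 hy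
    exact ⟨i, j, hi, hj, fun s => by rw [← h, ← h']⟩

theorem lcsLength_eq_listLcs {n : ℕ} (x y : Fin n → A) :
    lcsLength x y = listLcs (List.ofFn x) (List.ofFn y) := by
  unfold lcsLength listLcs
  congr 1
  ext k
  exact hasCommonSubseq_iff x y k

/-- A pair of words together with a letter at which the two words are matched. -/
abbrev Cell (A : Type*) := (List A × List A) × A

/-- An alignment of two words: a list of cells, then a final pair of words. -/
abbrev Alignment (A : Type*) := List (Cell A) × (List A × List A)

/-- The first word of an alignment. -/
def word₁ : List (Cell A) → List A → List A
  | [], f => f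
  | c :: L, f => c.1.1 ++ c.2 :: word₁ L f

/-- The second word of an alignment. -/
def word₂ : List (Cell A) → List A → List A
  | [], f => f
  | c :: L, f => c.1.2 ++ c.2 :: word₂ L f

theorem length_le_word₁ (L : List (Cell A)) (f : List A) : L.length ≤ (word₁ L f).length := by
  induction L with
  | nil => simp
  | cons c L ih => simp [word₁]; omega

/-- The alignment with the two words exchanged. -/
def swapCells (L : List (Cell A)) : List (Cell A) := L.map fun c => (c.1.swap, c.2)

theorem word₁_swapCells (L : List (Cell A)) (f : List A) :
    word₁ (swapCells L) f = word₂ L f := by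
  induction L with
  | nil => rfl
  | cons c L ih => simp [swapCells, word₁, word₂] at ih ⊢; exact ih

theorem word₂_swapCells (L : List (Cell A)) (f : List A) :
    word₂ (swapCells L) f = word₁ L f := by
  induction L with
  | nil => rfl
  | cons c L ih => simp [swapCells, word₁, word₂] at ih ⊢; exact ih

end Lists

/-! ### Optimal alignments and the effect of changing one letter into `o` -/

section Decomposition

variable {A : Type*} [DecidableEq A] (o : A)

/-- The number of letters of `x` different from `o`. -/
def rares (x : List A) : ℕ := x.countP (fun a => decide (a ≠ o))

theorem commonSublist_min_count (x y : List A) :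
    CommonSublist x y (min (x.count o) (y.count o)) :=
  ⟨List.replicate (min (x.count o) (y.count o)) o,
    List.replicate_sublist_iff.2 (min_le_left _ _),
    List.replicate_sublist_iff.2 (min_le_right _ _), by simp⟩

/-- The length of the common sublist obtained by matching the final letters of the cells, and as
many letters `o` as possible in each pair of words. -/
def score : List (Cell A) → List A × List A → ℕ
  | [], f => min (f.1.count o) (f.2.count o)
  | c :: L, f => min (c.1.1.count o) (c.1.2.count o) + 1 + score L f

theorem commonSublist_score (L : List (Cell A)) (f : List A × List A) :
    CommonSublist (word₁ L f.1) (word₂ L f.2) (score o L f) := by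
  induction L with
  | nil => exact commonSublist_min_count o _ _
  | cons c L ih =>
    have := (commonSublist_min_count o c.1.1 c.1.2).append (ih.cons c.2)
    simpa only [word₁, word₂, score, add_assoc, add_comm (score o L f) 1] using this

/-- Enlarging the first piece can only help, since the minimum of counts is superadditive. -/
theorem exists_prepend (u v : List A) (L : List (Cell A)) (f : List A × List A)
    (hL : ∀ c ∈ L, c.2 ≠ o) :
    ∃ L' f', (∀ c ∈ L', c.2 ≠ o) ∧ word₁ L' f'.1 = u ++ word₁ L f.1 ∧
      word₂ L' f'.2 = v ++ word₂ L f.2 ∧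
      min (u.count o) (v.count o) + score o L f ≤ score o L' f' := by
  cases L with
  | nil =>
    refine ⟨[], (u ++ f.1, v ++ f.2), by simp, rfl, rfl, ?_⟩
    simp only [score, List.count_append]; omega
  | cons c L =>
    refine ⟨((u ++ c.1.1, v ++ c.1.2), c.2) :: L, f, ?_, by simp [word₁], by simp [word₂], ?_⟩
    · intro d hd
      rcases List.mem_cons.1 hd with rfl | hd
      · exact hL c (by simp)
      · exact hL d (by simp [hd])
    · simp only [score, List.count_append]; omega

/-- Read the common sublist from the left: a rare letter opens a new cell, while a letter `o` is
absorbed into the first piece of what follows. -/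
theorem exists_alignment (l x y : List A) (hx : l.Sublist x) (hy : l.Sublist y) :
    ∃ L f, (∀ c ∈ L, c.2 ≠ o) ∧ word₁ L f.1 = x ∧ word₂ L f.2 = y ∧ l.length ≤ score o L f := by
  induction l generalizing x y with
  | nil => exact ⟨[], (x, y), by simp, rfl, rfl, by simp⟩
  | cons a l ih =>
    obtain ⟨r, r', rfl, har, hr⟩ := List.cons_sublist_iff.1 hx
    obtain ⟨s, s', rfl, has, hs⟩ := List.cons_sublist_iff.1 hy
    obtain ⟨L, f, hL, h1, h2, h3⟩ := ih r' s' hr hs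
    by_cases ha : a = o
    · obtain ⟨L', f', hL', h1', h2', h3'⟩ := exists_prepend o r s L f hL
      refine ⟨L', f', hL', by rw [h1', h1], by rw [h2', h2], ?_⟩
      have e1 : 0 < r.count o := List.count_pos_iff.2 (ha ▸ har)
      have e2 : 0 < s.count o := List.count_pos_iff.2 (ha ▸ has)
      simp only [List.length_cons]; omega
    · obtain ⟨u, v, rfl⟩ := List.append_of_mem har
      obtain ⟨u', v', rfl⟩ := List.append_of_mem has
      obtain ⟨L', f', hL', h1', h2', h3'⟩ := exists_prepend o v v' L f hL
      refine ⟨((u, u'), a) :: L', f', ?_, by simp [word₁, h1', h1], by simp [word₂, h2', h2], ?_⟩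
      · intro c hc
        rcases List.mem_cons.1 hc with rfl | hc
        · exact ha
        · exact hL' c hc
      · simp only [List.length_cons, score]; omega

/-- No letter different from `o` can be matched inside the pair `(x, y)` without losing in the
number of matched letters. -/
def Unsplittable (x y : List A) : Prop :=
  ∀ u v u' v' : List A, ∀ a : A, a ≠ o → x = u ++ a :: v → y = u' ++ a :: v' →
    min (u.count o) (u'.count o) + 1 + min (v.count o) (v'.count o) < min (x.count o) (y.count o)

/-- A piece that is not unsplittable contains a rare match whose use as a new cell does not lower
the score. -/
theorem exists_split (L : List (Cell A)) (f : List A × List A) (hL : ∀ c ∈ L, c.2 ≠ o)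
    (h : ¬ ((∀ c ∈ L, Unsplittable o c.1.1 c.1.2) ∧ Unsplittable o f.1 f.2)) :
    ∃ L' f', (∀ c ∈ L', c.2 ≠ o) ∧ word₁ L' f'.1 = word₁ L f.1 ∧ word₂ L' f'.2 = word₂ L f.2 ∧
      score o L f ≤ score o L' f' ∧ L'.length = L.length + 1 := by
  induction L with
  | nil =>
    have h : ¬ Unsplittable o f.1 f.2 := fun hf => h ⟨by simp, hf⟩
    unfold Unsplittable at h
    push Not at h
    obtain ⟨u, v, u', v', a, ha, h1, h2, h3⟩ := h
    exact ⟨[((u, u'), a)], (v, v'), by simpa using ha, by simp [word₁, h1], by simp [word₂, h2],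
      by simpa [score] using h3, rfl⟩
  | cons c L ih =>
    by_cases hc : Unsplittable o c.1.1 c.1.2
    · obtain ⟨L', f', hL', h1, h2, h3, h4⟩ := ih (fun d hd => hL d (by simp [hd])) (fun hh => h
        ⟨fun d hd => by
          rcases List.mem_cons.1 hd with rfl | hd
          · exact hc
          · exact hh.1 d hd, hh.2⟩)
      refine ⟨c :: L', f', ?_, by simp [word₁, h1], by simp [word₂, h2], by simp [score, h3],
        by simp [h4]⟩
      intro d hd
      rcases List.mem_cons.1 hd with rfl | hd
      · exact hL d (by simp)
      · exact hL' d hd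
    · unfold Unsplittable at hc
      push Not at hc
      obtain ⟨u, v, u', v', a, ha, h1, h2, h3⟩ := hc
      refine ⟨((u, u'), a) :: ((v, v'), c.2) :: L, f, ?_, by simp [word₁, h1],
        by simp [word₂, h2], ?_, rfl⟩
      · intro d hd
        simp only [List.mem_cons] at hd
        rcases hd with rfl | rfl | hd
        · exact ha
        · exact hL c (by simp)
        · exact hL d (by simp [hd])
      · simp only [score]; omega

/-- There is an optimal alignment all of whose pieces are unsplittable. -/
theorem exists_unsplittable_alignment (x y : List A) :
    ∃ L f, (∀ c ∈ L, c.2 ≠ o) ∧ word₁ L f.1 = x ∧ word₂ L f.2 = y ∧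
      score o L f = listLcs x y ∧ (∀ c ∈ L, Unsplittable o c.1.1 c.1.2) ∧
      Unsplittable o f.1 f.2 := by
  -- Splitting keeps optimality and adds one cell. The number of cells is at most the length of `x`,
  -- so the process stops; `k` is the remaining room.
  have step : ∀ k L f, (∀ c ∈ L, c.2 ≠ o) → word₁ L f.1 = x → word₂ L f.2 = y →
      score o L f = listLcs x y → x.length ≤ L.length + k →
      ∃ L f, (∀ c ∈ L, c.2 ≠ o) ∧ word₁ L f.1 = x ∧ word₂ L f.2 = y ∧
      score o L f = listLcs x y ∧ (∀ c ∈ L, Unsplittable o c.1.1 c.1.2) ∧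
      Unsplittable o f.1 f.2 := by
    intro k
    induction k with
    | zero =>
      intro L f hL h1 h2 h3 h4
      by_cases h : (∀ c ∈ L, Unsplittable o c.1.1 c.1.2) ∧ Unsplittable o f.1 f.2
      · exact ⟨L, f, hL, h1, h2, h3, h⟩
      · obtain ⟨L', f', hL', h1', h2', h3', h4'⟩ := exists_split o L f hL h
        have := length_le_word₁ L' f'.1
        rw [h1', h1] at this
        omega
    | succ k ih =>
      intro L f hL h1 h2 h3 h4
      by_cases h : (∀ c ∈ L, Unsplittable o c.1.1 c.1.2) ∧ Unsplittable o f.1 f.2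
      · exact ⟨L, f, hL, h1, h2, h3, h⟩
      · obtain ⟨L', f', hL', h1', h2', h3', h4'⟩ := exists_split o L f hL h
        have h5 := (commonSublist_score o L' f').le_listLcs
        rw [h1', h1, h2', h2] at h5
        exact ih L' f' hL' (h1'.trans h1) (h2'.trans h2) (by omega) (by omega)
  obtain ⟨l, hx, hy, hl⟩ := commonSublist_listLcs x y
  obtain ⟨L, f, hL, h1, h2, h3⟩ := exists_alignment o l x y hx hy
  have h5 := (commonSublist_score o L f).le_listLcs
  rw [h1, h2] at h5
  exact step x.length L f hL h1 h2 (by omega) (by omega)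

/-- The sum of `F` over all words obtained from a word by changing one letter into `o`, this letter
being different from `o`. -/
def sumFlip (F : List A → ℤ) : List A → ℤ
  | [] => 0
  | a :: l => (if a ≠ o then F (o :: l) else 0) + sumFlip (fun l' => F (a :: l')) l

theorem sumFlip_append (F : List A → ℤ) (u v : List A) :
    sumFlip o F (u ++ v) =
      sumFlip o (fun u' => F (u' ++ v)) u + sumFlip o (fun v' => F (u ++ v')) v := by
  induction u generalizing F with
  | nil => simp [sumFlip]
  | cons a u ih => simp [sumFlip, ih, add_assoc]

theorem sumFlip_mono {F F' : List A → ℤ} (x : List A) (h : ∀ l, F l ≤ F' l) :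
    sumFlip o F x ≤ sumFlip o F' x := by
  induction x generalizing F F' with
  | nil => simp [sumFlip]
  | cons a x ih =>
    have := ih (F := fun l' => F (a :: l')) (F' := fun l' => F' (a :: l')) (fun l => h _)
    have := h (o :: x)
    simp only [sumFlip]
    split_ifs <;> omega

theorem le_sumFlip_of_count {F : List A → ℤ} (c : ℤ) (x : List A)
    (h : ∀ l : List A, l.count o = x.count o + 1 → c ≤ F l) :
    c * rares o x ≤ sumFlip o F x := by
  induction x generalizing F with
  | nil => simp [sumFlip, rares]
  | cons a x ih =>
    have h1 := ih (F := fun l' => F (a :: l')) (fun l hl => h _ (by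
      simp only [List.count_cons, hl]; omega))
    by_cases ha : a = o
    · simpa [sumFlip, rares, ha] using h1
    · have h2 := h (o :: x) (by simp [ha])
      have : rares o (a :: x) = rares o x + 1 := by simp [rares, ha]
      simp only [sumFlip, this, ha, ne_eq, not_false_eq_true, if_true]
      push_cast
      linarith

/-- The number of letters of the first words of the pieces of an alignment whose change into `o`
increases the score. -/
def gain₁ : List (Cell A) → List A × List A → ℕ
  | [], f => if f.1.count o < f.2.count o then rares o f.1 else 0
  | c :: L, f => (if c.1.1.count o < c.1.2.count o then rares o c.1.1 else 0) + gain₁ L f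

/-- The number of letters of the second words of the pieces of an alignment whose change into `o`
increases the score. -/
def gain₂ : List (Cell A) → List A × List A → ℕ
  | [], f => if f.2.count o < f.1.count o then rares o f.2 else 0
  | c :: L, f => (if c.1.2.count o < c.1.1.count o then rares o c.1.2 else 0) + gain₂ L f

theorem gain_le_sumFlip_min (x y : List A) :
    ((if x.count o < y.count o then rares o x else 0 : ℕ) : ℤ) ≤
      sumFlip o (fun x' => ((min (x'.count o) (y.count o) : ℕ) : ℤ)
        - (min (x.count o) (y.count o) : ℕ)) x := by
  split_ifs with h
  · have := le_sumFlip_of_count (F := fun x' => ((min (x'.count o) (y.count o) : ℕ) : ℤ)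
        - (min (x.count o) (y.count o) : ℕ)) o 1 x (fun l hl => by omega)
    simpa using this
  · have := le_sumFlip_of_count (F := fun x' => ((min (x'.count o) (y.count o) : ℕ) : ℤ)
        - (min (x.count o) (y.count o) : ℕ)) o 0 x (fun l hl => by omega)
    simpa using this

/-- Keep the alignment after the change: a rare letter in a piece whose first word has fewer `o`
gains one, any other rare letter in a piece loses nothing, and each of the matched rare letters
loses at most its own match. The subtracted length accounts for the latter. -/
theorem gain₁_le_sumFlip (L : List (Cell A)) (f : List A × List A) :
    (gain₁ o L f : ℤ) - L.length ≤
      sumFlip o (fun x' => (listLcs x' (word₂ L f.2) : ℤ) - score o L f) (word₁ L f.1) := by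
  induction L with
  | nil =>
    simp only [gain₁, List.length_nil, word₁, word₂, score, Nat.cast_zero, sub_zero]
    refine (gain_le_sumFlip_min o f.1 f.2).trans (sumFlip_mono o _ fun l => ?_)
    have := (commonSublist_min_count o l f.2).le_listLcs
    omega
  | cons c L ih =>
    simp only [gain₁, List.length_cons, word₁, word₂, score]
    rw [sumFlip_append]
    simp only [sumFlip]
    have h1 := (gain_le_sumFlip_min o c.1.1 c.1.2).trans
      (sumFlip_mono o (F' := fun x' => (listLcs (x' ++ c.2 :: word₁ L f.1)
        (c.1.2 ++ c.2 :: word₂ L f.2) : ℤ) -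
          ((min (c.1.1.count o) (c.1.2.count o) + 1 + score o L f : ℕ) : ℤ)) _ fun l => by
        have := ((commonSublist_min_count o l c.1.2).append
          ((commonSublist_score o L f).cons c.2)).le_listLcs
        push_cast at this ⊢
        omega)
    have h2 := ih.trans
      (sumFlip_mono o (F' := fun x' => (listLcs (c.1.1 ++ c.2 :: x')
        (c.1.2 ++ c.2 :: word₂ L f.2) : ℤ) -
          ((min (c.1.1.count o) (c.1.2.count o) + 1 + score o L f : ℕ) : ℤ)) _ fun l => by
        have := ((commonSublist_min_count o c.1.1 c.1.2).append
          ((commonSublist_listLcs l (word₂ L f.2)).cons c.2)).le_listLcs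
        push_cast at this ⊢
        omega)
    -- The change hits the matched letter of the cell itself, which forfeits that single match.
    have h3 := ((commonSublist_min_count o c.1.1 c.1.2).append
          ((commonSublist_score o L f).cons_right o c.2)).le_listLcs
    push_cast at h1 h2 h3 ⊢
    split_ifs at h1 ⊢ <;> omega

theorem gain₁_swapCells (L : List (Cell A)) (f : List A × List A) :
    gain₁ o (swapCells L) f.swap = gain₂ o L f := by
  induction L with
  | nil => rfl
  | cons c L ih => simp [swapCells, gain₁, gain₂] at ih ⊢; exact ih

theorem score_swapCells (L : List (Cell A)) (f : List A × List A) :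
    score o (swapCells L) f.swap = score o L f := by
  induction L with
  | nil => simp [swapCells, score, min_comm]
  | cons c L ih => simp [swapCells, score] at ih ⊢; rw [min_comm, ih]

theorem gain₂_le_sumFlip (L : List (Cell A)) (f : List A × List A) :
    (gain₂ o L f : ℤ) - L.length ≤
      sumFlip o (fun y' => (listLcs (word₁ L f.1) y' : ℤ) - score o L f) (word₂ L f.2) := by
  have := gain₁_le_sumFlip o (swapCells L) f.swap
  simp only [Prod.fst_swap, Prod.snd_swap, word₁_swapCells, word₂_swapCells, gain₁_swapCells,
    score_swapCells] at this
  simpa [swapCells, listLcs_comm] using this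

/-- The total number of unmatched letters `o` of an alignment. -/
def unmatched : List (Cell A) → List A × List A → ℕ
  | [], f => (f.1.count o - f.2.count o) + (f.2.count o - f.1.count o)
  | c :: L, f => (c.1.1.count o - c.1.2.count o) + (c.1.2.count o - c.1.1.count o) + unmatched L f

/-- Double counting: every `o` is matched or unmatched, and each cell adds two matched letters that
are not `o`. -/
theorem unmatched_add_score (L : List (Cell A)) (f : List A × List A) (hL : ∀ c ∈ L, c.2 ≠ o) :
    unmatched o L f + 2 * score o L f =
      2 * L.length + (word₁ L f.1).count o + (word₂ L f.2).count o := by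
  induction L with
  | nil => simp only [unmatched, score, word₁, word₂, List.length_nil]; omega
  | cons c L ih =>
    have := ih (fun d hd => hL d (by simp [hd]))
    have hc := hL c (by simp)
    simp only [unmatched, score, word₁, word₂, List.length_cons, List.count_append,
      List.count_cons_of_ne hc]
    omega

/-- The number of unmatched letters `o` in an optimal alignment. -/
theorem unmatched_le (L : List (Cell A)) (f : List A × List A) (hL : ∀ c ∈ L, c.2 ≠ o)
    (h : score o L f = listLcs (word₁ L f.1) (word₂ L f.2)) :
    (unmatched o L f : ℤ) ≤
      2 * L.length + |((word₁ L f.1).count o : ℤ) - (word₂ L f.2).count o| := by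
  have h1 := unmatched_add_score o L f hL
  -- Matching letters `o` only is a competitor to the optimal alignment.
  have h2 := (commonSublist_min_count o (word₁ L f.1) (word₂ L f.2)).le_listLcs
  rw [← h] at h2
  rcases abs_cases (((word₁ L f.1).count o : ℤ) - (word₂ L f.2).count o) with h | h <;> omega

end Decomposition

open scoped ENNReal

/-! ### Geometric series over lists -/

section Sums

theorem tsum_tuple_prod {S : Type*} (f : S → ℝ≥0∞) (n : ℕ) :
    ∑' v : Fin n → S, ((List.ofFn v).map f).prod = (∑' s, f s) ^ n := by
  induction n with
  | zero => simp [tsum_fintype]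
  | succ n ih =>
    rw [← (Fin.consEquiv (fun _ : Fin (n + 1) => S)).tsum_eq, ENNReal.tsum_prod', pow_succ',
      ← ih, ← ENNReal.tsum_mul_right]
    refine tsum_congr fun a => ?_
    rw [← ENNReal.tsum_mul_left]
    refine tsum_congr fun v => ?_
    simp [Fin.consEquiv, List.ofFn_succ]

theorem tsum_list_prod {S : Type*} (f : S → ℝ≥0∞) :
    ∑' l : List S, (l.map f).prod = (1 - ∑' s, f s)⁻¹ := by
  rw [← List.equivSigmaTuple.symm.tsum_eq, ENNReal.tsum_sigma', ← ENNReal.tsum_geometric]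
  exact tsum_congr fun n => tsum_tuple_prod f n

/-- Only a section of `g` over the support is needed, so decompositions of words need not be shown
unique. -/
theorem tsum_le_tsum_comp {X Y : Type*} (f : Y → ℝ≥0∞) (g : X → Y)
    (h : ∀ y, f y ≠ 0 → ∃ x, g x = y) : ∑' y, f y ≤ ∑' x, f (g x) := by
  choose i' hi' using h
  let i : Function.support f → X := fun y => i' y y.2
  have hi : ∀ y, g (i y) = y := fun y => hi' y y.2
  rw [← tsum_subtype_support f]
  calc ∑' y : Function.support f, f y = ∑' y : Function.support f, f (g (i y)) :=
        tsum_congr fun y => by rw [hi y]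
    _ ≤ ∑' x, f (g x) := ENNReal.tsum_comp_le_tsum_of_injective
        (f := i) (fun a b hab => by
          have := congrArg g hab
          rw [hi a, hi b] at this
          exact Subtype.ext this) (fun x => f (g x))

end Sums

/-! ### Generating functions of words and of unsplittable pairs -/

section Words

variable {A : Type*}

/-- The product of the weights of the letters of a word. -/
noncomputable def wt (g : A → ℝ≥0∞) (x : List A) : ℝ≥0∞ := (x.map g).prod

@[simp] theorem wt_nil (g : A → ℝ≥0∞) : wt g [] = 1 := by simp [wt]

@[simp] theorem wt_cons (g : A → ℝ≥0∞) (a : A) (x : List A) : wt g (a :: x) = g a * wt g x := by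
  simp [wt]

@[simp] theorem wt_append (g : A → ℝ≥0∞) (x y : List A) :
    wt g (x ++ y) = wt g x * wt g y := by simp [wt]

variable (o : A)

/-- A word in letters different from `o`, as a word in all letters. -/
def raresWord (w : List {a : A // a ≠ o}) : List A := w.map Subtype.val

/-- The total weight of the words in letters different from `o`. -/
noncomputable def runSum (g : A → ℝ≥0∞) : ℝ≥0∞ := ∑' w, wt g (raresWord o w)

theorem runSum_eq (g : A → ℝ≥0∞) : runSum o g = (1 - ∑' a : {a : A // a ≠ o}, g a)⁻¹ := by
  rw [runSum, ← tsum_list_prod]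
  exact tsum_congr fun w => by simp [wt, raresWord]

/-- Four words in letters different from `o`: the first two runs of two words. -/
abbrev Runs := (List {a : A // a ≠ o} × List {a : A // a ≠ o}) ×
  (List {a : A // a ≠ o} × List {a : A // a ≠ o})

/-- The weight of four runs and of the four letters `o` which follow them. -/
noncomputable def runsWt (g : A → ℝ≥0∞) (Q : Runs o) : ℝ≥0∞ :=
  wt g (raresWord o Q.1.1) * wt g (raresWord o Q.1.2) *
    (wt g (raresWord o Q.2.1) * wt g (raresWord o Q.2.2)) * g o ^ 4

/-- Runs which contain a pair of letters that can be matched. -/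
def matchRuns : {a : A // a ≠ o} ⊕ {a : A // a ≠ o} ⊕ {a : A // a ≠ o} → Runs o
  | .inl a => (([a], []), ([a], []))
  | .inr (.inl a) => (([], [a]), ([], [a]))
  | .inr (.inr a) => (([a], []), ([], [a]))

theorem matchRuns_injective : Function.Injective (matchRuns o) := by
  rintro (a | a | a) (b | b | b) h <;> simp_all [matchRuns]

variable [DecidableEq A]

@[simp] theorem count_raresWord (w : List {a : A // a ≠ o}) : (raresWord o w).count o = 0 := by
  rw [List.count_eq_zero]
  simp [raresWord]

theorem exists_raresWord_eq {x : List A} (h : x.count o = 0) : ∃ w, raresWord o w = x := by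
  rw [List.count_eq_zero] at h
  refine ⟨x.attach.map fun a => ⟨a.1, fun ha => h (ha ▸ a.2)⟩, ?_⟩
  simp [raresWord, Function.comp_def]

theorem exists_raresWord_append {x : List A} {k : ℕ} (h : x.count o = k + 1) :
    ∃ w x', raresWord o w ++ o :: x' = x ∧ x'.count o = k := by
  have hm : o ∈ x := List.count_pos_iff.1 (by omega)
  obtain ⟨u, v, rfl, hu⟩ := List.eq_append_cons_of_mem hm
  obtain ⟨w, rfl⟩ := exists_raresWord_eq o (List.count_eq_zero.2 hu)
  exact ⟨w, v, rfl, by simpa using h⟩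

/-- A word with `k` letters `o` consists of `k + 1` runs of rare letters separated by these letters.
-/
theorem tsum_count_le (g : A → ℝ≥0∞) (k : ℕ) :
    ∑' x : List A, (if x.count o = k then wt g x else 0) ≤
      runSum o g * (runSum o g * g o) ^ k := by
  induction k with
  | zero =>
    refine (tsum_le_tsum_comp _ (raresWord o) fun x hx => ?_).trans ?_
    · exact exists_raresWord_eq o (by by_contra h; simp [h] at hx)
    · simp [runSum]
  | succ k ih =>
    refine (tsum_le_tsum_comp _ (fun d : List {a : A // a ≠ o} × List A =>
      raresWord o d.1 ++ o :: d.2) fun x hx => ?_).trans ?_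
    · obtain ⟨w, x', h, -⟩ := exists_raresWord_append (x := x) (k := k) o
        (by by_contra h; simp [h] at hx)
      exact ⟨(w, x'), h⟩
    · rw [ENNReal.tsum_prod']
      have : ∀ w : List {a : A // a ≠ o}, ∀ x' : List A,
          (if (raresWord o w ++ o :: x').count o = k + 1
            then wt g (raresWord o w ++ o :: x') else 0) =
          wt g (raresWord o w) * (g o * if x'.count o = k then wt g x' else 0) := by
        intro w x'
        simp
      simp only [this, ENNReal.tsum_mul_left, ENNReal.tsum_mul_right]
      rw [← runSum]
      calc runSum o g * (g o * ∑' x : List A, (if x.count o = k then wt g x else 0))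
          ≤ runSum o g * (g o * (runSum o g * (runSum o g * g o) ^ k)) := by gcongr
        _ = _ := by ring

/-- The total weight of the pairs of words such that the second one contains more letters `o`,
each letter `o` in excess being given the additional weight `τ`. -/
theorem tsum_excess_le (g g' : A → ℝ≥0∞) (τ : ℝ≥0∞) :
    ∑' d : List A × List A, (if d.1.count o < d.2.count o then
        wt g' d.1 * wt g d.2 * τ ^ (d.2.count o - d.1.count o) else 0) ≤
      runSum o g' * runSum o g * (1 - (runSum o g' * g' o) * (runSum o g * g o))⁻¹ *
        ((runSum o g * g o * τ) * (1 - runSum o g * g o * τ)⁻¹) := by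
  have h1 : ∀ d : List A × List A, (if d.1.count o < d.2.count o then
        wt g' d.1 * wt g d.2 * τ ^ (d.2.count o - d.1.count o) else 0) ≤
      ∑' k : ℕ, ∑' j : ℕ, (if d.1.count o = k then wt g' d.1 else 0) *
        (if d.2.count o = k + j + 1 then wt g d.2 else 0) * τ ^ (j + 1) := by
    intro d
    split_ifs with h
    · refine le_trans ?_ (ENNReal.le_tsum (d.1.count o))
      refine le_trans ?_ (ENNReal.le_tsum (d.2.count o - d.1.count o - 1))
      rw [if_pos rfl, if_pos (by omega)]
      rw [show d.2.count o - d.1.count o - 1 + 1 = d.2.count o - d.1.count o by omega]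
    · exact zero_le
  calc _ ≤ ∑' d : List A × List A, ∑' k : ℕ, ∑' j : ℕ,
        (if d.1.count o = k then wt g' d.1 else 0) *
        (if d.2.count o = k + j + 1 then wt g d.2 else 0) * τ ^ (j + 1) := ENNReal.tsum_le_tsum h1
    _ = ∑' k : ℕ, ∑' j : ℕ, (∑' x : List A, if x.count o = k then wt g' x else 0) *
        (∑' y : List A, if y.count o = k + j + 1 then wt g y else 0) * τ ^ (j + 1) := by
      rw [ENNReal.tsum_comm]
      refine tsum_congr fun k => ?_
      rw [ENNReal.tsum_comm]
      refine tsum_congr fun j => ?_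
      rw [ENNReal.tsum_prod', ← ENNReal.tsum_mul_right, ← ENNReal.tsum_mul_right]
      refine tsum_congr fun x => ?_
      dsimp only
      rw [ENNReal.tsum_mul_right]
      exact congrArg (· * τ ^ (j + 1)) (ENNReal.tsum_mul_left
        (a := if x.count o = k then wt g' x else 0)
        (f := fun y : List A => if y.count o = k + j + 1 then wt g y else 0))
    _ ≤ ∑' k : ℕ, ∑' j : ℕ, (runSum o g' * (runSum o g' * g' o) ^ k) *
        (runSum o g * (runSum o g * g o) ^ (k + j + 1)) * τ ^ (j + 1) := by
      gcongr <;> exact tsum_count_le o _ _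
    _ = ∑' k : ℕ, ∑' j : ℕ, (runSum o g' * runSum o g *
        ((runSum o g' * g' o) * (runSum o g * g o)) ^ k) * ((runSum o g * g o * τ) *
        (runSum o g * g o * τ) ^ j) := by
      refine tsum_congr fun k => tsum_congr fun j => ?_
      ring
    _ = _ := by
      simp only [ENNReal.tsum_mul_left, ENNReal.tsum_mul_right, ENNReal.tsum_geometric]

/-- The weight of the unsplittable pairs of words with `k` letters `o` each. -/
noncomputable def unsplitSum (g : A → ℝ≥0∞) (k : ℕ) : ℝ≥0∞ := by
  classical
  exact ∑' d : List A × List A, (if d.1.count o = k ∧ d.2.count o = k ∧ Unsplittable o d.1 d.2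
    then wt g d.1 * wt g d.2 else 0)

theorem unsplitSum_le (g : A → ℝ≥0∞) (k : ℕ) :
    unsplitSum o g k ≤ (runSum o g * (runSum o g * g o) ^ k) ^ 2 := by
  classical
  calc unsplitSum o g k ≤ ∑' d : List A × List A, (if d.1.count o = k then wt g d.1 else 0) *
        (if d.2.count o = k then wt g d.2 else 0) := by
        refine ENNReal.tsum_le_tsum fun d => ?_
        split_ifs <;> simp_all
    _ = (∑' x : List A, if x.count o = k then wt g x else 0) *
        (∑' x : List A, if x.count o = k then wt g x else 0) := by
        rw [ENNReal.tsum_prod', ← ENNReal.tsum_mul_right]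
        refine tsum_congr fun x => ?_
        exact ENNReal.tsum_mul_left (a := if x.count o = k then wt g x else 0)
          (f := fun y : List A => if y.count o = k then wt g y else 0)
    _ ≤ _ := by
        rw [sq]
        gcongr <;> exact tsum_count_le o _ _

/-- Two words starting with given runs. -/
def joinRuns (d : Runs o × (List A × List A)) : List A × List A :=
  (raresWord o d.1.1.1 ++ o :: (raresWord o d.1.1.2 ++ o :: d.2.1),
    raresWord o d.1.2.1 ++ o :: (raresWord o d.1.2.2 ++ o :: d.2.2))

theorem Unsplittable.of_joinRuns {Q : Runs o} {d : List A × List A}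
    (h : Unsplittable o (joinRuns o (Q, d)).1 (joinRuns o (Q, d)).2) :
    Unsplittable o d.1 d.2 := by
  intro u v u' v' a ha h1 h2
  have := h (raresWord o Q.1.1 ++ o :: (raresWord o Q.1.2 ++ o :: u)) v
    (raresWord o Q.2.1 ++ o :: (raresWord o Q.2.2 ++ o :: u')) v' a ha (by simp [joinRuns, h1])
    (by simp [joinRuns, h2])
  simp [joinRuns] at this
  omega

/-- In the first two patterns the match lies in equally numbered runs and costs no `o`. In the third
it is shifted by one run, so one `o` of each word is left over and the new match makes up for it. -/
theorem not_unsplittable_joinRuns (s : {a : A // a ≠ o} ⊕ {a : A // a ≠ o} ⊕ {a : A // a ≠ o})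
    {d : List A × List A} {k : ℕ} (h1 : d.1.count o = k) (h2 : d.2.count o = k) :
    ¬ Unsplittable o (joinRuns o (matchRuns o s, d)).1 (joinRuns o (matchRuns o s, d)).2 := by
  intro h
  rcases s with a | a | a
  · have := h [] (o :: o :: d.1) [] (o :: o :: d.2) a a.2 (by simp [joinRuns, matchRuns, raresWord])
      (by simp [joinRuns, matchRuns, raresWord])
    simp [joinRuns, h1, h2] at this
    omega
  · have := h [o] (o :: d.1) [o] (o :: d.2) a a.2 (by simp [joinRuns, matchRuns, raresWord])
      (by simp [joinRuns, matchRuns, raresWord])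
    simp [joinRuns, h1, h2] at this
  · have := h [] (o :: o :: d.1) [o] (o :: d.2) a a.2 (by simp [joinRuns, matchRuns, raresWord])
      (by simp [joinRuns, matchRuns, raresWord])
    simp [joinRuns, h1, h2] at this

/-- The total weight of the runs without matching letters. -/
noncomputable def freeRunsSum (g : A → ℝ≥0∞) : ℝ≥0∞ :=
  ∑' Q : Runs o, (Set.range (matchRuns o))ᶜ.indicator (runsWt o g) Q

/-- Strip the first two runs of both words, each with its following `o`. The runs must avoid the
three matching patterns, and the remaining pair is still unsplittable. -/
theorem unsplitSum_add_two_le (g : A → ℝ≥0∞) (k : ℕ) :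
    unsplitSum o g (k + 2) ≤ freeRunsSum o g * unsplitSum o g k := by
  classical
  unfold unsplitSum
  refine (tsum_le_tsum_comp _ (joinRuns o) fun d hd => ?_).trans ?_
  · have hd : d.1.count o = k + 2 ∧ d.2.count o = k + 2 := by
      by_contra h
      exact hd (if_neg fun h' => h ⟨h'.1, h'.2.1⟩)
    obtain ⟨w, x, h1, h2⟩ := exists_raresWord_append o hd.1
    obtain ⟨w', x', rfl, h2'⟩ := exists_raresWord_append o h2
    obtain ⟨v, y, h3, h4⟩ := exists_raresWord_append o hd.2
    obtain ⟨v', y', rfl, h4'⟩ := exists_raresWord_append o h4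
    exact ⟨(((w, w'), (v, v')), (x', y')), Prod.ext h1 h3⟩
  · rw [ENNReal.tsum_prod', freeRunsSum, ← ENNReal.tsum_mul_right]
    refine ENNReal.tsum_le_tsum fun Q => ?_
    rw [← ENNReal.tsum_mul_left]
    refine ENNReal.tsum_le_tsum fun d => ?_
    split_ifs with h1 h2 h2
    · have hQ : Q ∈ (Set.range (matchRuns o))ᶜ := by
        rintro ⟨s, rfl⟩
        exact not_unsplittable_joinRuns o s h2.1 h2.2.1 h1.2.2
      rw [Set.indicator_of_mem hQ, runsWt]
      simp only [joinRuns, wt_append, wt_cons]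
      apply le_of_eq
      ring
    · exact absurd ⟨by simpa [joinRuns] using h1.1, by simpa [joinRuns] using h1.2.1,
        Unsplittable.of_joinRuns o h1.2.2⟩ h2
    · exact zero_le
    · exact zero_le

/-- All quadruples of runs together weigh `(runSum o g * g o) ^ 4`; each of the three distinct
forbidden families takes away the sum of the squared rare weights times `g o ^ 4`. -/
theorem freeRunsSum_add_le [Fintype A] (g : A → ℝ≥0∞) :
    freeRunsSum o g + 3 * (∑ a : {a : A // a ≠ o}, g a ^ 2) * g o ^ 4 ≤
      (runSum o g * g o) ^ 4 := by
  have h1 : ∑' Q : Runs o, runsWt o g Q = (runSum o g * g o) ^ 4 := by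
    simp only [runsWt, ENNReal.tsum_prod', ENNReal.tsum_mul_right, ENNReal.tsum_mul_left]
    rw [← runSum]
    ring
  have h2 : ∑' Q : Runs o, (Set.range (matchRuns o)).indicator (runsWt o g) Q =
      3 * (∑ a : {a : A // a ≠ o}, g a ^ 2) * g o ^ 4 := by
    rw [← tsum_subtype, tsum_range _ (matchRuns_injective o), tsum_fintype,
      Fintype.sum_sum_type, Fintype.sum_sum_type]
    simp only [matchRuns, runsWt, raresWord, List.map_cons, List.map_nil, wt_cons, wt_nil,
      mul_one, one_mul, ← sq, ← Finset.sum_mul]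
    ring
  rw [← h1, ← h2, freeRunsSum, add_comm, ← ENNReal.tsum_add]
  refine le_of_eq (tsum_congr fun Q => ?_)
  rw [Set.indicator_self_add_compl_apply]

/-- Stripping two letters `o` at a time gives one geometric series for even `k` and one for odd `k`,
starting at 0 and 1. -/
theorem tsum_unsplitSum_le (g : A → ℝ≥0∞) :
    ∑' k, unsplitSum o g k ≤
      (runSum o g ^ 2 + runSum o g ^ 4 * g o ^ 2) * (1 - freeRunsSum o g)⁻¹ := by
  have h0 : ∀ i j, unsplitSum o g (2 * j + i) ≤ freeRunsSum o g ^ j * unsplitSum o g i := by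
    intro i j
    induction j with
    | zero => simp
    | succ j ih =>
      rw [show 2 * (j + 1) + i = 2 * j + i + 2 by ring]
      refine (unsplitSum_add_two_le o g _).trans ?_
      calc _ ≤ freeRunsSum o g * (freeRunsSum o g ^ j * unsplitSum o g i) := by gcongr
        _ = _ := by ring
  rw [← tsum_even_add_odd ENNReal.summable ENNReal.summable]
  calc _ ≤ ∑' j, freeRunsSum o g ^ j * unsplitSum o g 0 +
        ∑' j, freeRunsSum o g ^ j * unsplitSum o g 1 := by
        gcongr with j j
        · exact h0 0 j
        · exact h0 1 j
    _ ≤ ∑' j, freeRunsSum o g ^ j * (runSum o g * (runSum o g * g o) ^ 0) ^ 2 +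
        ∑' j, freeRunsSum o g ^ j * (runSum o g * (runSum o g * g o) ^ 1) ^ 2 := by
        gcongr <;> exact unsplitSum_le o g _
    _ = _ := by
        rw [ENNReal.tsum_mul_right, ENNReal.tsum_mul_right, ENNReal.tsum_geometric]
        ring

end Words

/-! ### The total weight of all alignments -/

section Codes

variable {A : Type*} [DecidableEq A] (o : A)

/-- The weight of a pair of words in an alignment. -/
noncomputable def pieceWt (g : A → ℝ≥0∞) (τ : ℝ≥0∞) (d : List A × List A) : ℝ≥0∞ := by
  classical
  exact if Unsplittable o d.1 d.2 then wt g d.1 * wt g d.2 *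
    τ ^ ((if d.1.count o < d.2.count o then rares o d.1 else 0) +
      (if d.2.count o < d.1.count o then rares o d.2 else 0) +
      ((d.1.count o - d.2.count o) + (d.2.count o - d.1.count o))) else 0

/-- The letter weights with an additional weight `τ` for the letters different from `o`. -/
noncomputable def tilt (g : A → ℝ≥0∞) (τ : ℝ≥0∞) (a : A) : ℝ≥0∞ := if a = o then g a else g a * τ

theorem wt_tilt (g : A → ℝ≥0∞) (τ : ℝ≥0∞) (x : List A) :
    wt (tilt o g τ) x = wt g x * τ ^ rares o x := by
  induction x with
  | nil => simp [rares]
  | cons a x ih =>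
    by_cases h : a = o
    · simp only [rares] at ih; simp [rares, h, tilt, ih]; ring
    · simp only [rares] at ih; simp [rares, h, tilt, ih]; ring

/-- The two symmetric unbalanced cases are bounded without unsplittability: the factor `τ` on the
rare letters of the poorer side and on the excess of `o` suffices. Balanced pieces carry no factor
`τ`, and there unsplittability is needed. -/
theorem tsum_pieceWt_le (g : A → ℝ≥0∞) (τ : ℝ≥0∞) :
    ∑' d, pieceWt o g τ d ≤
      2 * (runSum o (tilt o g τ) * runSum o g *
        (1 - (runSum o (tilt o g τ) * g o) * (runSum o g * g o))⁻¹ *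
        ((runSum o g * g o * τ) * (1 - runSum o g * g o * τ)⁻¹)) +
      (runSum o g ^ 2 + runSum o g ^ 4 * g o ^ 2) * (1 - freeRunsSum o g)⁻¹ := by
  classical
  set e : List A × List A → ℝ≥0∞ := fun d => if d.1.count o < d.2.count o then
        wt (tilt o g τ) d.1 * wt g d.2 * τ ^ (d.2.count o - d.1.count o) else 0 with he
  have h1 := tsum_excess_le o g (tilt o g τ) τ
  rw [show tilt o g τ o = g o by simp [tilt]] at h1
  have h2 : ∑' d, e (Prod.swap d) = ∑' d, e d := (Equiv.prodComm _ _).tsum_eq e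
  have h3 : ∀ d, pieceWt o g τ d ≤ e d + e d.swap + ∑' k,
      (if d.1.count o = k ∧ d.2.count o = k ∧ Unsplittable o d.1 d.2
        then wt g d.1 * wt g d.2 else 0) := by
    intro d
    unfold pieceWt
    split_ifs with hu h h' h'
    · omega
    · refine le_trans ?_ (le_add_right (le_add_right le_rfl))
      simp only [he, h, if_true, wt_tilt]
      rw [show d.1.count o - d.2.count o = 0 by omega, add_zero, zero_add, pow_add]
      apply le_of_eq; ring
    · refine le_trans ?_ (le_add_right (le_add_left le_rfl))
      simp only [he, Prod.fst_swap, Prod.snd_swap, h', if_true, wt_tilt]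
      rw [show d.2.count o - d.1.count o = 0 by omega, add_zero, zero_add, pow_add]
      apply le_of_eq; ring
    · refine le_trans ?_ (le_add_left (ENNReal.le_tsum (d.1.count o)))
      rw [if_pos ⟨rfl, by omega, hu⟩, show d.1.count o - d.2.count o = 0 by omega,
        show d.2.count o - d.1.count o = 0 by omega]
      simp
    · exact zero_le
  calc _ ≤ ∑' d : List A × List A, (e d + e d.swap + ∑' k,
      (if d.1.count o = k ∧ d.2.count o = k ∧ Unsplittable o d.1 d.2
        then wt g d.1 * wt g d.2 else 0)) := ENNReal.tsum_le_tsum h3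
    _ = 2 * ∑' d, e d + ∑' k, unsplitSum o g k := by
      rw [ENNReal.tsum_add, ENNReal.tsum_add, h2, two_mul, ENNReal.tsum_comm]
      rfl
    _ ≤ _ := by
      gcongr
      exact tsum_unsplitSum_le o g

/-- The weight of a cell of an alignment. -/
noncomputable def cellWt (g : A → ℝ≥0∞) (τ t : ℝ≥0∞) (c : Cell A) : ℝ≥0∞ :=
  pieceWt o g τ c.1 * (if c.2 = o then 0 else g c.2 ^ 2 * t ^ 4)

/-- The weight of an alignment. -/
noncomputable def alignmentWt (g : A → ℝ≥0∞) (τ t : ℝ≥0∞) (π : Alignment A) : ℝ≥0∞ :=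
  (π.1.map (cellWt o g τ t)).prod * pieceWt o g τ π.2

theorem alignmentWt_eq (g : A → ℝ≥0∞) (τ t : ℝ≥0∞) (L : List (Cell A)) (f : List A × List A)
    (hL : ∀ c ∈ L, c.2 ≠ o) (h : ∀ c ∈ L, Unsplittable o c.1.1 c.1.2)
    (hf : Unsplittable o f.1 f.2) :
    alignmentWt o g τ t (L, f) = wt g (word₁ L f.1) * wt g (word₂ L f.2) *
      (t ^ (4 * L.length) * τ ^ (gain₁ o L f + gain₂ o L f + unmatched o L f)) := by
  induction L with
  | nil =>
    simp [alignmentWt, pieceWt, hf, gain₁, gain₂, unmatched, word₁, word₂]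
  | cons c L ih =>
    have h1 := ih (fun d hd => hL d (by simp [hd])) (fun d hd => h d (by simp [hd]))
    have h2 : alignmentWt o g τ t (c :: L, f) = cellWt o g τ t c * alignmentWt o g τ t (L, f) := by
      simp [alignmentWt, mul_assoc]
    rw [h2, h1, cellWt, if_neg (hL c (by simp)), pieceWt, if_pos (h c (by simp))]
    simp only [gain₁, gain₂, unmatched, word₁, word₂, wt_append, wt_cons, List.length_cons,
      pow_add, mul_add, mul_one]
    ring

/-- Cells are chosen independently, so the list of cells is a geometric series whose ratio is the
total weight of one cell. -/
theorem tsum_alignmentWt [Fintype A] (g : A → ℝ≥0∞) (τ t : ℝ≥0∞) :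
    ∑' π, alignmentWt o g τ t π =
      (1 - (∑' d, pieceWt o g τ d) * ((∑ a : {a : A // a ≠ o}, g a ^ 2) * t ^ 4))⁻¹ *
        ∑' d, pieceWt o g τ d := by
  have h1 : ∑' c, cellWt o g τ t c =
      (∑' d, pieceWt o g τ d) * ((∑ a : {a : A // a ≠ o}, g a ^ 2) * t ^ 4) := by
    simp only [cellWt]
    rw [ENNReal.tsum_prod']
    simp only [ENNReal.tsum_mul_left, ENNReal.tsum_mul_right]
    congr 1
    rw [tsum_fintype, Finset.sum_mul,
      ← Finset.sum_subtype (Finset.univ.filter fun a => a ≠ o) (fun a => by simp)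
      (fun a => g a ^ 2 * t ^ 4), Finset.sum_filter]
    refine Finset.sum_congr rfl fun a _ => ?_
    by_cases h : a = o <;> simp [h]
  rw [← h1, ← tsum_list_prod, ENNReal.tsum_prod']
  simp only [alignmentWt, ENNReal.tsum_mul_left, ENNReal.tsum_mul_right]

end Codes

/-! ### Numerical convergence for τ = 20/21 and letter weights inflated by 1 + q²/1000 -/

section Estimates

variable {A : Type*} [Fintype A] [DecidableEq A]

/-- The letter `o` has probability close to one, and `q` is the largest probability of the other
letters. -/
structure DominantLetter (p : A → ℝ) (o : A) (q : ℝ) : Prop where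
  nonneg : ∀ a, 0 ≤ p a
  sum_eq : ∑ a, p a = 1
  q_pos : 0 < q
  q_le : q ≤ 1 / 1000000
  le_q : ∀ a, a ≠ o → p a ≤ q
  exists_eq : ∃ a, a ≠ o ∧ p a = q
  large : 999 / 1000 ≤ p o

namespace DominantLetter

variable {p : A → ℝ} {o : A} {q : ℝ}

theorem sum_rare (h : DominantLetter p o q) : ∑ a : {a : A // a ≠ o}, p a = 1 - p o := by
  rw [← h.sum_eq, Fintype.sum_eq_add_sum_subtype_ne p o]
  ring

theorem q_le_eps (h : DominantLetter p o q) : q ≤ 1 - p o := by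
  obtain ⟨a, ha, rfl⟩ := h.exists_eq
  rw [← h.sum_rare]
  exact Finset.single_le_sum (f := fun a : {a : A // a ≠ o} => p a) (fun a _ => h.nonneg a)
    (Finset.mem_univ ⟨a, ha⟩)

theorem sq_le_sum_sq (h : DominantLetter p o q) : q ^ 2 ≤ ∑ a : {a : A // a ≠ o}, p a ^ 2 := by
  obtain ⟨a, ha, rfl⟩ := h.exists_eq
  exact Finset.single_le_sum (f := fun a : {a : A // a ≠ o} => p a ^ 2) (fun a _ => sq_nonneg _)
    (Finset.mem_univ ⟨a, ha⟩)

theorem sum_sq_le (h : DominantLetter p o q) : ∑ a : {a : A // a ≠ o}, p a ^ 2 ≤ q * (1 - p o) := by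
  rw [← h.sum_rare, Finset.mul_sum]
  refine Finset.sum_le_sum fun a _ => ?_
  rw [sq]
  exact mul_le_mul_of_nonneg_right (h.le_q a a.2) (h.nonneg a)

end DominantLetter

theorem inv_one_sub_le {x : ℝ≥0∞} {r c : ℝ} (hx : x ≤ ENNReal.ofReal r) (hr : 0 ≤ r) (hc : 0 < c)
    (h : c ≤ 1 - r) : (1 - x)⁻¹ ≤ ENNReal.ofReal (1 / c) := by
  rw [one_div, ENNReal.ofReal_inv_of_pos hc]
  refine ENNReal.inv_le_inv.2 ?_
  calc ENNReal.ofReal c ≤ ENNReal.ofReal (1 - r) := ENNReal.ofReal_le_ofReal h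
    _ = 1 - ENNReal.ofReal r := by rw [ENNReal.ofReal_sub _ hr, ENNReal.ofReal_one]
    _ ≤ 1 - x := tsub_le_tsub_left hx 1

/-- The letter weights `p a * (1 + q ^ 2 / 1000)`. -/
noncomputable def growthWt (p : A → ℝ) (q : ℝ) (a : A) : ℝ≥0∞ :=
  ENNReal.ofReal (p a * (1 + q ^ 2 / 1000))

theorem runSum_le (g : A → ℝ≥0∞) (o : A) {r c : ℝ} (hr : 0 ≤ r) (hc : 0 < c)
    (hg : ∑ a : {a : A // a ≠ o}, g a ≤ ENNReal.ofReal r) (h : c ≤ 1 - r) :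
    runSum o g ≤ ENNReal.ofReal (1 / c) := by
  rw [runSum_eq, tsum_fintype]
  exact inv_one_sub_le hg hr hc h

/-- The letter `o` has weight at most one. -/
theorem mul_growth_le {P q : ℝ} (hq : 0 < q) (hq1 : q ≤ 1 / 1000000) (hP : q ≤ 1 - P) :
    P * (1 + q ^ 2 / 1000) ≤ 1 := by
  nlinarith [mul_pos hq hq]

namespace DominantLetter

variable {p : A → ℝ} {o : A} {q : ℝ}

theorem sum_growthWt (h : DominantLetter p o q) : ∑ a : {a : A // a ≠ o}, growthWt p q a =
    ENNReal.ofReal ((1 - p o) * (1 + q ^ 2 / 1000)) := by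
  rw [← h.sum_rare, Finset.sum_mul, ENNReal.ofReal_sum_of_nonneg]
  · rfl
  · exact fun a _ => mul_nonneg (h.nonneg a) (by positivity)

theorem sum_growthWt_sq (h : DominantLetter p o q) : ∑ a : {a : A // a ≠ o}, growthWt p q a ^ 2 =
    ENNReal.ofReal ((∑ a : {a : A // a ≠ o}, p a ^ 2) * (1 + q ^ 2 / 1000) ^ 2) := by
  rw [Finset.sum_mul, ENNReal.ofReal_sum_of_nonneg]
  · refine Finset.sum_congr rfl fun a _ => ?_
    rw [growthWt, ← ENNReal.ofReal_pow (mul_nonneg (h.nonneg a) (by positivity)), mul_pow]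
  · exact fun a _ => by positivity

theorem runSum_growthWt_le (h : DominantLetter p o q) : runSum o (growthWt p q) ≤
    ENNReal.ofReal (1 / (1 - (1 - p o) * (1 + q ^ 2 / 1000))) := by
  have h1 := h.q_le_eps
  have h2 := h.large
  have h3 := h.q_le
  have h4 := h.q_pos
  refine runSum_le _ o (by nlinarith) ?_ h.sum_growthWt.le le_rfl
  nlinarith

/-- Without inflation the product is exactly 1, so it exceeds 1 only by the order of the inflation.
-/
theorem runSum_growthWt_mul_le (h : DominantLetter p o q) :
    runSum o (growthWt p q) * growthWt p q o ≤
    ENNReal.ofReal (1 + q ^ 2 / 500) := by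
  have h1 := h.q_le_eps
  have h2 := h.large
  have h3 := h.q_le
  have h4 := h.q_pos
  have h5 : 0 < 1 - (1 - p o) * (1 + q ^ 2 / 1000) := by nlinarith
  calc _ ≤ ENNReal.ofReal (1 / (1 - (1 - p o) * (1 + q ^ 2 / 1000))) * growthWt p q o := by
        gcongr; exact h.runSum_growthWt_le
    _ = ENNReal.ofReal (1 / (1 - (1 - p o) * (1 + q ^ 2 / 1000)) * (p o * (1 + q ^ 2 / 1000))) := by
        rw [growthWt, ← ENNReal.ofReal_mul (by positivity)]
    _ ≤ _ := by
        refine ENNReal.ofReal_le_ofReal ?_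
        rw [one_div, inv_mul_le_iff₀ h5]
        have h6 : 0 ≤ q ^ 2 * (1 - 2 * ((1 - p o) * (1 + q ^ 2 / 1000))) :=
          mul_nonneg (sq_nonneg q) (by nlinarith)
        linarith

theorem runSum_growthWt_le_const (h : DominantLetter p o q) :
    runSum o (growthWt p q) ≤ ENNReal.ofReal (1002 / 1000) := by
  have h1 := h.q_le_eps
  have h2 := h.large
  have h3 := h.q_le
  have h4 := h.q_pos
  have h5 : 1000 / 1002 < 1 - (1 - p o) * (1 + q ^ 2 / 1000) := by nlinarith
  refine h.runSum_growthWt_le.trans (ENNReal.ofReal_le_ofReal ?_)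
  rw [div_le_div_iff₀ (by linarith) (by norm_num)]
  linarith

theorem sum_tilt (h : DominantLetter p o q) :
    ∑ a : {a : A // a ≠ o}, tilt o (growthWt p q) (ENNReal.ofReal (20 / 21)) a =
    ENNReal.ofReal ((1 - p o) * (1 + q ^ 2 / 1000) * (20 / 21)) := by
  have h1 := h.q_le_eps
  have h4 := h.q_pos
  rw [ENNReal.ofReal_mul (by apply mul_nonneg <;> [linarith; positivity]), ← h.sum_growthWt,
    Finset.sum_mul]
  refine Finset.sum_congr rfl fun a _ => ?_
  simp [tilt, a.2]

theorem runSum_tilt_le (h : DominantLetter p o q) :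
    runSum o (tilt o (growthWt p q) (ENNReal.ofReal (20 / 21))) ≤
    ENNReal.ofReal (1 / (1 - (1 - p o) * (1 + q ^ 2 / 1000) * (20 / 21))) := by
  have h1 := h.q_le_eps
  have h2 := h.large
  have h3 := h.q_le
  have h4 := h.q_pos
  refine runSum_le _ o (by nlinarith) ?_ h.sum_tilt.le le_rfl
  nlinarith

theorem runSum_tilt_le_const (h : DominantLetter p o q) :
    runSum o (tilt o (growthWt p q) (ENNReal.ofReal (20 / 21))) ≤
    ENNReal.ofReal (1002 / 1000) := by
  have h1 := h.q_le_eps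
  have h2 := h.large
  have h3 := h.q_le
  have h4 := h.q_pos
  have h5 : 1000 / 1002 < 1 - (1 - p o) * (1 + q ^ 2 / 1000) * (20 / 21) := by nlinarith
  refine h.runSum_tilt_le.trans (ENNReal.ofReal_le_ofReal ?_)
  rw [div_le_div_iff₀ (by linarith) (by norm_num)]
  linarith

/-- The factor 20/21 on rare letters removes about `(1 - p o) / 21`, which dominates the inflation
of order q² because `q ≤ 1 - p o`. -/
theorem runSum_tilt_mul_le (h : DominantLetter p o q) :
    runSum o (tilt o (growthWt p q) (ENNReal.ofReal (20 / 21))) * growthWt p q o ≤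
      ENNReal.ofReal (1 - (1 - p o) / 22) := by
  have h1 := h.q_le_eps
  have h2 := h.large
  have h3 := h.q_le
  have h4 := h.q_pos
  have h5 : 0 < 1 - (1 - p o) * (1 + q ^ 2 / 1000) * (20 / 21) := by nlinarith
  calc _ ≤ ENNReal.ofReal (1 / (1 - (1 - p o) * (1 + q ^ 2 / 1000) * (20 / 21))) *
        growthWt p q o := by
        gcongr; exact h.runSum_tilt_le
    _ = ENNReal.ofReal (1 / (1 - (1 - p o) * (1 + q ^ 2 / 1000) * (20 / 21)) *
        (p o * (1 + q ^ 2 / 1000))) := by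
        rw [growthWt, ← ENNReal.ofReal_mul (by positivity)]
    _ ≤ _ := by
        refine ENNReal.ofReal_le_ofReal ?_
        rw [one_div, inv_mul_le_iff₀ h5]
        have h6 : q ^ 2 ≤ (1 - p o) / 1000000 := by nlinarith
        have h7 : 0 < q ^ 2 := by positivity
        generalize hx : 1 - p o = x at *
        have h8 : p o = 1 - x := by linarith
        have h9 : x ≤ 1 / 1000 := by linarith
        rw [h8]
        have hx0 : 0 ≤ x := by linarith
        have h10 : 0 ≤ x * q ^ 2 := by positivity
        have h11 : x * q ^ 2 ≤ q ^ 2 := by nlinarith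
        nlinarith [sq_nonneg x, mul_nonneg h10 hx0]

theorem runSum_mul_runSum_le (h : DominantLetter p o q) :
    (runSum o (tilt o (growthWt p q) (ENNReal.ofReal (20 / 21))) * growthWt p q o) *
      (runSum o (growthWt p q) * growthWt p q o) ≤ ENNReal.ofReal (1 - (1 - p o) / 25) := by
  have h1 := h.q_le_eps
  have h2 := h.large
  have h3 := h.q_le
  have h4 := h.q_pos
  refine (mul_le_mul' h.runSum_tilt_mul_le h.runSum_growthWt_mul_le).trans ?_
  rw [← ENNReal.ofReal_mul (by linarith)]
  refine ENNReal.ofReal_le_ofReal ?_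
  have h6 : q ^ 2 ≤ (1 - p o) / 1000000 := by nlinarith
  nlinarith [sq_nonneg q]

/-- The inflation costs at most 9q²/1000, and q² is at most the sum of the squares, so it uses up
only a small part of the gain of nearly three times that sum. -/
theorem freeRunsSum_le (h : DominantLetter p o q) : freeRunsSum o (growthWt p q) ≤
    ENNReal.ofReal (1 - 296 / 100 * ∑ a : {a : A // a ≠ o}, p a ^ 2) := by
  have h1 := h.q_le_eps
  have h2 := h.large
  have h3 := h.q_le
  have h4 := h.q_pos
  have h5 := h.sq_le_sum_sq
  have h6 := h.sum_sq_le
  have h7 := freeRunsSum_add_le o (growthWt p q)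
  rw [h.sum_growthWt_sq, growthWt] at h7
  set s := ∑ a : {a : A // a ≠ o}, p a ^ 2
  have hs : 0 ≤ s := le_trans (sq_nonneg q) h5
  have hp : 0 ≤ p o := by linarith
  have h8 : 3 * ENNReal.ofReal (s * (1 + q ^ 2 / 1000) ^ 2) *
      ENNReal.ofReal (p o * (1 + q ^ 2 / 1000)) ^ 4 =
      ENNReal.ofReal (3 * (s * (1 + q ^ 2 / 1000) ^ 2) * (p o * (1 + q ^ 2 / 1000)) ^ 4) := by
    rw [← ENNReal.ofReal_pow (by positivity), ← ENNReal.ofReal_ofNat,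
      ← ENNReal.ofReal_mul (by positivity), ← ENNReal.ofReal_mul (by positivity)]
  have h9 : (runSum o (growthWt p q) * ENNReal.ofReal (p o * (1 + q ^ 2 / 1000))) ^ 4 ≤
      ENNReal.ofReal ((1 + q ^ 2 / 500) ^ 4) := by
    rw [ENNReal.ofReal_pow (by positivity)]
    gcongr
    exact h.runSum_growthWt_mul_le
  rw [h8] at h7
  refine (ENNReal.le_sub_of_add_le_right ENNReal.ofReal_ne_top (h7.trans h9)).trans ?_
  rw [← ENNReal.ofReal_sub _ (by positivity)]
  refine ENNReal.ofReal_le_ofReal ?_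
  have e1 : (1 + q ^ 2 / 500) ^ 4 ≤ 1 + 9 * (q ^ 2 / 1000) := by
    have : q ^ 2 ≤ 1 / 1000000 := by nlinarith
    have h0 : 0 ≤ q ^ 2 := sq_nonneg q
    generalize q ^ 2 = y at *
    have y2 : y ^ 2 ≤ y / 1000000 := by nlinarith
    have y3 : y ^ 3 ≤ y / 1000000 := by nlinarith
    have y4 : y ^ 4 ≤ y / 1000000 := by nlinarith [sq_nonneg y]
    ring_nf
    linarith
  have e2 : 99 / 100 ≤ (1 + q ^ 2 / 1000) ^ 2 * (p o * (1 + q ^ 2 / 1000)) ^ 4 := by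
    have a1 : 1 ≤ (1 + q ^ 2 / 1000) ^ 2 := one_le_pow₀ (by nlinarith [sq_nonneg q])
    have a2 : (999 / 1000 : ℝ) ^ 4 ≤ (p o * (1 + q ^ 2 / 1000)) ^ 4 :=
      pow_le_pow_left₀ (by norm_num) (by nlinarith [sq_nonneg q]) 4
    have a3 : (99 / 100 : ℝ) ≤ (999 / 1000 : ℝ) ^ 4 := by norm_num
    nlinarith
  have e3 : 3 * (s * (1 + q ^ 2 / 1000) ^ 2) * (p o * (1 + q ^ 2 / 1000)) ^ 4 =
      3 * s * ((1 + q ^ 2 / 1000) ^ 2 * (p o * (1 + q ^ 2 / 1000)) ^ 4) := by ring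
  rw [e3]
  nlinarith

theorem tsum_pieceWt_le_const (h : DominantLetter p o q) :
    ∑' d, pieceWt o (growthWt p q) (ENNReal.ofReal (20 / 21)) d ≤
      ENNReal.ofReal (2 * (1002 / 1000 * (1002 / 1000) * (25 / (1 - p o)) * 21) +
        203 / 100 * (1 / (296 / 100 * ∑ a : {a : A // a ≠ o}, p a ^ 2))) := by
  have h1 := h.q_le_eps
  have h2 := h.large
  have h3 := h.q_le
  have h4 := h.q_pos
  have h5 := h.sq_le_sum_sq
  have h6 := h.sum_sq_le
  refine (tsum_pieceWt_le o _ _).trans ?_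
  set s := ∑ a : {a : A // a ≠ o}, p a ^ 2
  have hs : 0 < s := lt_of_lt_of_le (by positivity) h5
  have hε : 0 < 1 - p o := by linarith
  have hε' : 0 < 1 - (1 - (1 - p o) / 25) := by linarith
  have k1 : (1 - (runSum o (tilt o (growthWt p q) (ENNReal.ofReal (20 / 21))) * growthWt p q o) *
      (runSum o (growthWt p q) * growthWt p q o))⁻¹ ≤ ENNReal.ofReal (25 / (1 - p o)) := by
    have := inv_one_sub_le (c := (1 - p o) / 25) h.runSum_mul_runSum_le (by linarith)
      (by linarith) (by linarith)
    rwa [one_div_div] at this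
  have k2 : runSum o (growthWt p q) * growthWt p q o * ENNReal.ofReal (20 / 21) ≤
      ENNReal.ofReal (21 / 22) := by
    calc _ ≤ ENNReal.ofReal (1 + q ^ 2 / 500) * ENNReal.ofReal (20 / 21) := by
          gcongr; exact h.runSum_growthWt_mul_le
      _ = ENNReal.ofReal ((1 + q ^ 2 / 500) * (20 / 21)) := by
          rw [ENNReal.ofReal_mul (by positivity)]
      _ ≤ _ := ENNReal.ofReal_le_ofReal (by nlinarith)
  have k3 : (1 - runSum o (growthWt p q) * growthWt p q o * ENNReal.ofReal (20 / 21))⁻¹ ≤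
      ENNReal.ofReal 22 := by
    have := inv_one_sub_le (c := 1 / 22) k2 (by norm_num) (by norm_num) (by norm_num)
    simpa using this
  have k4 : (1 - freeRunsSum o (growthWt p q))⁻¹ ≤ ENNReal.ofReal (1 / (296 / 100 * s)) :=
    inv_one_sub_le h.freeRunsSum_le (by nlinarith) (by positivity) (by linarith)
  have k5 : growthWt p q o ≤ 1 := by
    rw [growthWt, ← ENNReal.ofReal_one]
    exact ENNReal.ofReal_le_ofReal (mul_growth_le h4 h3 h1)
  have k6 := h.runSum_growthWt_le_const
  have k7 := h.runSum_tilt_le_const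
  calc _ ≤ 2 * (ENNReal.ofReal (1002 / 1000) * ENNReal.ofReal (1002 / 1000) *
        ENNReal.ofReal (25 / (1 - p o)) * (ENNReal.ofReal (21 / 22) * ENNReal.ofReal 22)) +
        (ENNReal.ofReal (1002 / 1000) ^ 2 + ENNReal.ofReal (1002 / 1000) ^ 4 * 1 ^ 2) *
          ENNReal.ofReal (1 / (296 / 100 * s)) := by gcongr
    _ = ENNReal.ofReal (2 * (1002 / 1000 * (1002 / 1000) * (25 / (1 - p o)) * (21 / 22 * 22)) +
        ((1002 / 1000) ^ 2 + (1002 / 1000) ^ 4) * (1 / (296 / 100 * s))) := by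
        rw [ENNReal.ofReal_add (by positivity) (by positivity), ENNReal.ofReal_mul (by positivity),
          ENNReal.ofReal_mul (by positivity), ENNReal.ofReal_mul (by positivity),
          ENNReal.ofReal_mul (by positivity), ENNReal.ofReal_mul (by positivity),
          ENNReal.ofReal_mul (by positivity), ENNReal.ofReal_add (by positivity) (by positivity),
          ENNReal.ofReal_pow (by positivity), ENNReal.ofReal_pow (by positivity)]
        simp
    _ ≤ _ := by
        refine ENNReal.ofReal_le_ofReal ?_
        gcongr <;> norm_num

/-- The total weight of all alignments is finite. -/
theorem tsum_alignmentWt_le (h : DominantLetter p o q) :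
    ∑' π, alignmentWt o (growthWt p q) (ENNReal.ofReal (20 / 21)) (ENNReal.ofReal (21 / 20)) π ≤
      ENNReal.ofReal (20 / q ^ 2) := by
  have h1 := h.q_le_eps
  have h2 := h.large
  have h3 := h.q_le
  have h4 := h.q_pos
  have h5 := h.sq_le_sum_sq
  have h6 := h.sum_sq_le
  have k := h.tsum_pieceWt_le_const
  rw [tsum_alignmentWt, h.sum_growthWt_sq]
  set s := ∑ a : {a : A // a ≠ o}, p a ^ 2
  have hs : 0 < s := lt_of_lt_of_le (by positivity) h5
  have hε : 0 < 1 - p o := by linarith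
  set F := 2 * (1002 / 1000 * (1002 / 1000) * (25 / (1 - p o)) * 21) +
        203 / 100 * (1 / (296 / 100 * s)) with hF
  have hF0 : 0 ≤ F := by positivity
  have e1 : F * s ≤ 71 / 100 := by
    -- The unbalanced pieces contribute only a multiple of q to `F * s`; the balanced ones
    -- contribute 203/296, slightly more than 2/3.
    have : s / (1 - p o) ≤ q := by rw [div_le_iff₀ hε]; exact h6
    have e : F * s = 2 * (1002 / 1000 * (1002 / 1000) * 25 * 21) * (s / (1 - p o)) +
        203 / 296 := by
      rw [hF]; field_simp
    rw [e]
    linarith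
  -- The ratio of the geometric series of cells; the gap below 1 leaves room for the factor
  -- (21/20)⁴.
  have e2 : F * (s * (1 + q ^ 2 / 1000) ^ 2 * (21 / 20) ^ 4) ≤ 95 / 100 := by
    have a1 : (1 + q ^ 2 / 1000) ^ 2 ≤ 101 / 100 := by
      have : q ^ 2 ≤ 1 / 1000000 := by nlinarith
      nlinarith [sq_nonneg q]
    calc _ = F * s * ((1 + q ^ 2 / 1000) ^ 2 * (21 / 20) ^ 4) := by ring
      _ ≤ 71 / 100 * (101 / 100 * (21 / 20) ^ 4) := by gcongr
      _ ≤ _ := by norm_num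
  have e3 : F ≤ 1 / q ^ 2 := by
    rw [le_div_iff₀ (by positivity)]
    nlinarith
  have k2 : (∑' d, pieceWt o (growthWt p q) (ENNReal.ofReal (20 / 21)) d) *
      (ENNReal.ofReal (s * (1 + q ^ 2 / 1000) ^ 2) * ENNReal.ofReal (21 / 20) ^ 4) ≤
      ENNReal.ofReal (95 / 100) := by
    calc _ ≤ ENNReal.ofReal F *
      (ENNReal.ofReal (s * (1 + q ^ 2 / 1000) ^ 2) * ENNReal.ofReal (21 / 20) ^ 4) := by gcongr
      _ = ENNReal.ofReal (F * (s * (1 + q ^ 2 / 1000) ^ 2 * (21 / 20) ^ 4)) := by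
        rw [← ENNReal.ofReal_pow (by positivity), ← ENNReal.ofReal_mul (by positivity),
          ← ENNReal.ofReal_mul hF0]
      _ ≤ _ := ENNReal.ofReal_le_ofReal e2
  have k3 := inv_one_sub_le (c := 1 / 20) k2 (by norm_num) (by norm_num) (by norm_num)
  calc _ ≤ ENNReal.ofReal (1 / (1 / 20)) * ENNReal.ofReal F := by gcongr
    _ = ENNReal.ofReal (20 * F) := by
      rw [ENNReal.ofReal_mul (by norm_num)]; norm_num
    _ ≤ _ := ENNReal.ofReal_le_ofReal (by rw [div_eq_mul_one_div]; linarith)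

end DominantLetter

end Estimates

/-! ### Words on which changes into `o` have little effect -/

section Bad

variable {A : Type*}

theorem wt_ofFn (g : A → ℝ≥0∞) {n : ℕ} (x : Fin n → A) : wt g (List.ofFn x) = ∏ i, g (x i) := by
  simp [wt, List.map_ofFn, List.prod_ofFn]

variable [DecidableEq A]

/-- The sum of the changes of the length of the longest common sublist caused by changing one
letter of one of the two words into `o`. -/
noncomputable def flipSum (o : A) (x y : List A) : ℤ :=
  sumFlip o (fun x' => (listLcs x' y : ℤ) - listLcs x y) x +
    sumFlip o (fun y' => (listLcs x y' : ℤ) - listLcs x y) y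

/-- The 4 per cell comes from two matched letters whose change may lose one each, and from two units
in the bound on unmatched `o`. The factor `t ^ 4` per cell cancels exactly this part of the exponent
of `τ`. -/
theorem exists_alignment_of_flipSum_le (o : A) (g : A → ℝ≥0∞) {τ t : ℝ≥0∞} (hτ : τ ≤ 1)
    (ht : t * τ = 1) (x y : List A) (E : ℕ)
    (h : flipSum o x y + |(x.count o : ℤ) - y.count o| ≤ E) :
    ∃ π : Alignment A, word₁ π.1 π.2.1 = x ∧ word₂ π.1 π.2.2 = y ∧
      wt g x * wt g y * τ ^ E ≤ alignmentWt o g τ t π := by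
  obtain ⟨L, f, hL, rfl, rfl, hs, hu, hf⟩ := exists_unsplittable_alignment o x y
  refine ⟨(L, f), rfl, rfl, ?_⟩
  rw [alignmentWt_eq o g τ t L f hL hu hf]
  have h1 := gain₁_le_sumFlip o L f
  have h2 := gain₂_le_sumFlip o L f
  have h3 := unmatched_le o L f hL hs
  rw [hs] at h1 h2
  simp only [flipSum] at h
  have h4 : gain₁ o L f + gain₂ o L f + unmatched o L f ≤ 4 * L.length + E := by omega
  gcongr
  calc τ ^ E = (t * τ) ^ (4 * L.length) * τ ^ E := by rw [ht]; simp
    _ = t ^ (4 * L.length) * τ ^ (4 * L.length + E) := by ring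
    _ ≤ _ := by
      gcongr t ^ _ * ?_
      exact pow_le_pow_of_le_one zero_le hτ h4

/-- With exponentially small probability, the changes of one letter into `o` have a small effect
on the longest common sublist. -/
theorem DominantLetter.sum_flipSum_le [Fintype A] {p : A → ℝ} {o : A} {q : ℝ}
    (h : DominantLetter p o q) {n : ℕ} (B : Finset ((Fin n → A) × (Fin n → A))) (E : ℕ)
    (hB : ∀ d ∈ B, flipSum o (List.ofFn d.1) (List.ofFn d.2) +
      |((List.ofFn d.1).count o : ℤ) - (List.ofFn d.2).count o| ≤ E) :
    (∑ d ∈ B, (∏ i, p (d.1 i)) * ∏ i, p (d.2 i)) * (1 + q ^ 2 / 1000) ^ (2 * n) ≤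
      (21 / 20) ^ E * (20 / q ^ 2) := by
  have hq := h.q_pos
  have hτ : ENNReal.ofReal (20 / 21) ≤ 1 := by
    rw [← ENNReal.ofReal_one]; exact ENNReal.ofReal_le_ofReal (by norm_num)
  have ht : ENNReal.ofReal (21 / 20) * ENNReal.ofReal (20 / 21) = 1 := by
    rw [← ENNReal.ofReal_mul (by norm_num)]; norm_num
  have hex : ∀ d : B, ∃ π : Alignment A, word₁ π.1 π.2.1 = List.ofFn d.1.1 ∧
      word₂ π.1 π.2.2 = List.ofFn d.1.2 ∧
      wt (growthWt p q) (List.ofFn d.1.1) * wt (growthWt p q) (List.ofFn d.1.2) *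
        ENNReal.ofReal (20 / 21) ^ E ≤
        alignmentWt o (growthWt p q) (ENNReal.ofReal (20 / 21)) (ENNReal.ofReal (21 / 20)) π :=
    fun d => exists_alignment_of_flipSum_le o _ hτ ht _ _ E (hB d d.2)
  choose π hπ1 hπ2 hπ3 using hex
  -- The two words can be read off the alignment, so distinct bad pairs use distinct terms of the
  -- convergent sum.
  have hinj : Function.Injective π := by
    intro d d' hd
    have e1 : List.ofFn d.1.1 = List.ofFn d'.1.1 := by rw [← hπ1, ← hπ1, hd]
    have e2 : List.ofFn d.1.2 = List.ofFn d'.1.2 := by rw [← hπ2, ← hπ2, hd]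
    exact Subtype.ext (Prod.ext (List.ofFn_injective e1) (List.ofFn_injective e2))
  have h1 : ∑' d : B, wt (growthWt p q) (List.ofFn d.1.1) * wt (growthWt p q) (List.ofFn d.1.2) *
        ENNReal.ofReal (20 / 21) ^ E ≤ ENNReal.ofReal (20 / q ^ 2) :=
    (ENNReal.tsum_le_tsum hπ3).trans
      ((ENNReal.tsum_comp_le_tsum_of_injective hinj _).trans h.tsum_alignmentWt_le)
  have hw : ∀ x : Fin n → A, wt (growthWt p q) (List.ofFn x) =
      ENNReal.ofReal ((∏ i, p (x i)) * (1 + q ^ 2 / 1000) ^ n) := by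
    intro x
    rw [wt_ofFn]
    simp only [growthWt]
    rw [← ENNReal.ofReal_prod_of_nonneg (fun i _ => mul_nonneg (h.nonneg _) (by positivity)),
      Finset.prod_mul_distrib]
    simp
  have hp : ∀ x : Fin n → A, 0 ≤ ∏ i, p (x i) := fun x => Finset.prod_nonneg fun i _ => h.nonneg _
  have h2 : ∀ d : B, wt (growthWt p q) (List.ofFn d.1.1) * wt (growthWt p q) (List.ofFn d.1.2) *
        ENNReal.ofReal (20 / 21) ^ E = ENNReal.ofReal (((∏ i, p (d.1.1 i)) * ∏ i, p (d.1.2 i)) *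
        ((1 + q ^ 2 / 1000) ^ (2 * n) * (20 / 21) ^ E)) := by
    intro d
    rw [hw, hw, ← ENNReal.ofReal_mul (mul_nonneg (hp _) (by positivity)),
      ← ENNReal.ofReal_pow (by norm_num), ← ENNReal.ofReal_mul
        (mul_nonneg (mul_nonneg (hp _) (by positivity)) (mul_nonneg (hp _) (by positivity)))]
    congr 1
    ring
  simp only [h2] at h1
  rw [tsum_fintype, ← ENNReal.ofReal_sum_of_nonneg
    (fun d _ => mul_nonneg (mul_nonneg (hp _) (hp _)) (by positivity)),
    ENNReal.ofReal_le_ofReal_iff (by positivity),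
    Finset.sum_coe_sort B (fun d => ((∏ i, p (d.1 i)) * ∏ i, p (d.2 i)) *
        ((1 + q ^ 2 / 1000) ^ (2 * n) * (20 / 21) ^ E)), ← Finset.sum_mul] at h1
  have e : (21 / 20 : ℝ) ^ E * (20 / 21) ^ E = 1 := by rw [← mul_pow]; norm_num
  calc _ = (21 / 20 : ℝ) ^ E * (20 / 21) ^ E * ((∑ d ∈ B, (∏ i, p (d.1 i)) * ∏ i, p (d.2 i)) *
        (1 + q ^ 2 / 1000) ^ (2 * n)) := by rw [e, one_mul]
    _ = (21 / 20) ^ E * ((∑ d ∈ B, (∏ i, p (d.1 i)) * ∏ i, p (d.2 i)) *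
        ((1 + q ^ 2 / 1000) ^ (2 * n) * (20 / 21) ^ E)) := by ring
    _ ≤ _ := by gcongr

end Bad

/-! ### Counting rare coordinates -/

section RareCount

variable {ι A : Type*} [Fintype ι] [DecidableEq A]

/-- The number of coordinates different from `o`. -/
def rareCount (o : A) (s : ι → A) : ℝ := ∑ i, if s i ≠ o then 1 else 0

theorem rareCount_nonneg (o : A) (s : ι → A) : 0 ≤ rareCount o s :=
  Finset.sum_nonneg fun i _ => by split_ifs <;> norm_num

theorem rareCount_le (o : A) (s : ι → A) : rareCount o s ≤ Fintype.card ι := by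
  calc rareCount o s ≤ ∑ i : ι, (1 : ℝ) :=
        Finset.sum_le_sum fun i _ => by split_ifs <;> norm_num
    _ = _ := by simp

variable [DecidableEq ι]

theorem rareCount_update (o : A) (s : ι → A) (i : ι) (h : s i ≠ o) :
    rareCount o (Function.update s i o) = rareCount o s - 1 := by
  unfold rareCount
  rw [← Finset.add_sum_erase _ _ (Finset.mem_univ i),
    ← Finset.add_sum_erase (a := i) Finset.univ (fun i => if s i ≠ o then (1 : ℝ) else 0)
      (Finset.mem_univ i)]
  have : ∀ j ∈ Finset.univ.erase i, (if Function.update s i o j ≠ o then (1 : ℝ) else 0) =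
      if s j ≠ o then 1 else 0 := by
    intro j hj
    rw [Function.update_of_ne (Finset.ne_of_mem_erase hj)]
  rw [Finset.sum_congr rfl this]
  simp [h]

end RareCount

/-! ### Product expectations and discrete integration by parts -/

section Expectation

variable {ι A : Type*} [Fintype ι] [DecidableEq ι] [Fintype A]

/-- The expectation of `F` under the product of the laws `p`. -/
noncomputable def mean (p : A → ℝ) (F : (ι → A) → ℝ) : ℝ := ∑ s : ι → A, (∏ i, p (s i)) * F s

variable {p : A → ℝ}

theorem mean_add (F G : (ι → A) → ℝ) :
    mean p (fun s => F s + G s) = mean p F + mean p G := by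
  simp [mean, mul_add, Finset.sum_add_distrib]

theorem mean_sub (F G : (ι → A) → ℝ) :
    mean p (fun s => F s - G s) = mean p F - mean p G := by
  simp [mean, mul_sub, Finset.sum_sub_distrib]

theorem mean_const_mul (c : ℝ) (F : (ι → A) → ℝ) :
    mean p (fun s => c * F s) = c * mean p F := by
  simp only [mean, Finset.mul_sum]
  exact Finset.sum_congr rfl fun s _ => by ring

theorem mean_sum {κ : Type*} (t : Finset κ) (F : κ → (ι → A) → ℝ) :
    mean p (fun s => ∑ k ∈ t, F k s) = ∑ k ∈ t, mean p (F k) := by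
  simp only [mean, Finset.mul_sum]
  exact Finset.sum_comm

theorem mean_mono (hp : ∀ a, 0 ≤ p a) {F G : (ι → A) → ℝ} (h : ∀ s, F s ≤ G s) :
    mean p F ≤ mean p G :=
  Finset.sum_le_sum fun s _ =>
    mul_le_mul_of_nonneg_left (h s) (Finset.prod_nonneg fun i _ => hp (s i))

theorem mean_const (hp : ∑ a, p a = 1) (c : ℝ) : mean (ι := ι) p (fun _ => c) = c := by
  classical
  have : ∑ s : ι → A, ∏ i, p (s i) = 1 := by
    have := Finset.prod_univ_sum (fun _ : ι => (Finset.univ : Finset A)) (fun _ a => p a)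
    rw [Fintype.piFinset_univ] at this
    rw [← this]
    simp [hp]
  simp [mean, ← Finset.sum_mul, this]

/-- Resampling one coordinate does not change the expectation. -/
theorem mean_resample (hp : ∑ a, p a = 1) (i : ι) (F : (ι → A) → ℝ) :
    mean p F = mean p (fun s => ∑ a, p a * F (Function.update s i a)) := by
  have hw : ∀ (s : ι → A) (a : A), (∏ j, p (Function.update s i a j)) * p (s i) =
      (∏ j, p (s j)) * p a := by
    intro s a
    have h1 : ∀ j, p (Function.update s i a j) = Function.update (fun j => p (s j)) i (p a) j :=
      fun j => Function.apply_update (fun _ => p) s i a j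
    simp only [h1]
    rw [Finset.prod_update_of_mem (Finset.mem_univ i),
      ← Finset.mul_prod_erase Finset.univ (fun j => p (s j)) (Finset.mem_univ i),
      Finset.sdiff_singleton_eq_erase]
    ring
  -- Exchanging coordinate `i` with an independent copy is an involution that preserves the product
  -- weight.
  let e : (ι → A) × A ≃ (ι → A) × A :=
    { toFun := fun d => (Function.update d.1 i d.2, d.1 i)
      invFun := fun d => (Function.update d.1 i d.2, d.1 i)
      left_inv := fun d => by simp
      right_inv := fun d => by simp }
  calc mean p F = ∑ d : (ι → A) × A, (∏ j, p (d.1 j)) * p d.2 * F d.1 := by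
        rw [Fintype.sum_prod_type, mean]
        refine Finset.sum_congr rfl fun s _ => ?_
        dsimp only
        rw [← Finset.sum_mul, ← Finset.mul_sum, hp, mul_one]
    _ = ∑ d : (ι → A) × A, (∏ j, p (d.1 j)) * p d.2 * F (Function.update d.1 i d.2) := by
        rw [← e.sum_comp]
        refine Finset.sum_congr rfl fun d _ => ?_
        simp only [e, Equiv.coe_fn_mk, hw]
    _ = _ := by
        rw [Fintype.sum_prod_type, mean]
        refine Finset.sum_congr rfl fun s _ => ?_
        rw [Finset.mul_sum]
        exact Finset.sum_congr rfl fun a _ => by ring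

theorem mean_mul_eq_zero (hp : ∑ a, p a = 1) (i : ι) (u : A → ℝ) (hu : ∑ a, p a * u a = 0)
    (G : (ι → A) → ℝ) (hG : ∀ s a, G (Function.update s i a) = G s) :
    mean p (fun s => u (s i) * G s) = 0 := by
  rw [mean_resample hp i]
  simp only [Function.update_self, hG, ← mul_assoc, ← Finset.sum_mul, hu, zero_mul]
  exact mean_const hp 0

theorem mean_coord (hp : ∑ a, p a = 1) (i : ι) (u : A → ℝ) :
    mean p (fun s => u (s i)) = ∑ a, p a * u a := by
  rw [mean_resample hp i]
  simp only [Function.update_self]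
  exact mean_const hp _

/-- The second moment of a sum of independent centered variables. -/
theorem mean_sq_sum (hp : ∑ a, p a = 1) (u : A → ℝ) (hu : ∑ a, p a * u a = 0) (c : ι → ℝ) :
    mean p (fun s => (∑ i, c i * u (s i)) ^ 2) = (∑ i, c i ^ 2) * ∑ a, p a * u a ^ 2 := by
  have h1 : ∀ s : ι → A, (∑ i, c i * u (s i)) ^ 2 =
      ∑ i, ∑ j, c i * c j * (u (s i) * u (s j)) := by
    intro s
    rw [sq, Finset.sum_mul_sum]
    exact Finset.sum_congr rfl fun i _ => Finset.sum_congr rfl fun j _ => by ring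
  simp only [h1, mean_sum, mean_const_mul]
  rw [Finset.sum_mul]
  refine Finset.sum_congr rfl fun i _ => ?_
  rw [Finset.sum_eq_single i]
  · have := mean_coord hp i (fun a => u a ^ 2)
    simp only [← sq]
    rw [this]
  · intro j _ hj
    rw [mean_mul_eq_zero hp i u hu (fun s => u (s j)), mul_zero]
    intro s a
    rw [Function.update_of_ne hj]
  · simp

theorem mean_indicator_le (hp : ∀ a, 0 ≤ p a) (W : (ι → A) → ℝ) {b : ℝ} (hb : 0 < b) :
    mean p (fun s => if b < |W s| then (1 : ℝ) else 0) ≤ mean p (fun s => W s ^ 2) / b ^ 2 := by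
  rw [div_eq_inv_mul, ← mean_const_mul]
  refine mean_mono hp fun s => ?_
  split_ifs with h
  · rw [← div_eq_inv_mul, le_div_iff₀ (by positivity), one_mul, ← sq_abs (W s)]
    exact pow_le_pow_left₀ hb.le h.le 2
  · positivity

variable [DecidableEq A]

/-- The sum of the changes of `f` when one coordinate is changed into `o`. -/
def changeSum (o : A) (f : (ι → A) → ℝ) (s : ι → A) : ℝ :=
  ∑ i, if s i ≠ o then f (Function.update s i o) - f s else 0

/-- For each coordinate, replacing a rare value by `o` compares the events of having a rare value
and of having `o` there, of probabilities `1 - p o` and `p o`, the other coordinates being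
untouched. -/
theorem mean_flip (hp : ∑ a, p a = 1) (o : A) (H : (ι → A) → ℝ) :
    p o * mean p (fun s => ∑ i, if s i ≠ o then H (Function.update s i o) else 0) =
      (1 - p o) * mean p (fun s => (Fintype.card ι - rareCount o s) * H s) := by
  have hrare : ∑ a, (if a ≠ o then p a else 0) = 1 - p o := by
    rw [← hp, Fintype.sum_eq_add_sum_subtype_ne p o, ← Finset.sum_filter,
      Finset.sum_subtype (Finset.univ.filter fun a => a ≠ o) (p := fun a => a ≠ o)
        (fun a => by simp)]
    ring
  have h1 : ∀ s : ι → A, (Fintype.card ι - rareCount o s) * H s =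
      ∑ i, if s i = o then H s else 0 := by
    intro s
    have : (Fintype.card ι : ℝ) = ∑ i : ι, (1 : ℝ) := by simp
    rw [this, rareCount, ← Finset.sum_sub_distrib, Finset.sum_mul]
    refine Finset.sum_congr rfl fun i _ => ?_
    by_cases h : s i = o <;> simp [h]
  simp only [h1, mean_sum, Finset.mul_sum]
  refine Finset.sum_congr rfl fun i _ => ?_
  rw [mean_resample hp i, mean_resample hp i (fun s => if s i = o then H s else 0)]
  simp only [Function.update_self, Function.update_idem]
  have e1 : ∀ s : ι → A, ∑ a, p a * (if a ≠ o then H (Function.update s i o) else 0) =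
      (1 - p o) * H (Function.update s i o) := by
    intro s
    rw [← hrare, Finset.sum_mul]
    refine Finset.sum_congr rfl fun a _ => ?_
    by_cases h : a = o <;> simp [h]
  have e2 : ∀ s : ι → A, ∑ a, p a * (if a = o then H (Function.update s i a) else 0) =
      p o * H (Function.update s i o) := by
    intro s
    simp
  simp only [e1, e2, mean_const_mul]
  ring

/-- A discrete integration by parts for functions of independent variables. -/
theorem mean_changeSum (hp : ∑ a, p a = 1) (o : A) (f : (ι → A) → ℝ) (ψ : ℝ → ℝ) :
    p o * mean p (fun s => ψ (rareCount o s - 1) * changeSum o f s) =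
      mean p (fun s => (f s - mean p f) * ((1 - p o) * (Fintype.card ι - rareCount o s) *
        ψ (rareCount o s) - p o * rareCount o s * ψ (rareCount o s - 1))) := by
  -- A change into `o` lowers the rare count by exactly one, hence the shifted argument of `ψ`.
  -- Centering `f` does not affect its increments.
  have h := mean_flip hp o (fun s => ψ (rareCount o s) * (f s - mean p f))
  have h1 : ∀ s : ι → A, (∑ i, if s i ≠ o then ψ (rareCount o (Function.update s i o)) *
      (f (Function.update s i o) - mean p f) else 0) =
      ψ (rareCount o s - 1) * changeSum o f s +
        rareCount o s * (ψ (rareCount o s - 1) * (f s - mean p f)) := by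
    intro s
    rw [changeSum, Finset.mul_sum]
    conv_rhs => rw [rareCount, Finset.sum_mul, ← rareCount, ← Finset.sum_add_distrib]
    refine Finset.sum_congr rfl fun i _ => ?_
    split_ifs with hi
    · rw [rareCount_update o s i hi]; ring
    · simp
  simp only [h1, mean_add] at h
  rw [mul_add, ← mean_const_mul (p o) (fun s => rareCount o s *
    (ψ (rareCount o s - 1) * (f s - mean p f))), ← mean_const_mul (1 - p o)] at h
  rw [eq_sub_of_add_eq h, ← mean_sub]
  congr 1
  ext s
  ring

/-- A piecewise linear bump function. -/
noncomputable def tent (c l t : ℝ) : ℝ := max 0 (1 - |t - c| / l)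

theorem tent_nonneg (c l t : ℝ) : 0 ≤ tent c l t := le_max_left _ _

theorem tent_le_one {c l : ℝ} (hl : 0 < l) (t : ℝ) : tent c l t ≤ 1 :=
  max_le zero_le_one (by have := div_nonneg (abs_nonneg (t - c)) hl.le; linarith)

theorem abs_mul_tent_le {c l : ℝ} (hl : 0 < l) (t : ℝ) : |t - c| * tent c l t ≤ l := by
  rcases le_or_gt |t - c| l with h | h
  · nlinarith [abs_nonneg (t - c), tent_nonneg c l t, tent_le_one (c := c) hl t]
  · have : tent c l t = 0 := by
      apply max_eq_left
      have := (one_lt_div hl).2 h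
      linarith
    rw [this, mul_zero]
    exact hl.le

theorem abs_tent_sub_le {c l : ℝ} (hl : 0 < l) (t : ℝ) :
    |tent c l t - tent c l (t - 1)| ≤ 1 / l := by
  unfold tent
  rw [max_comm 0, max_comm 0]
  refine (abs_max_sub_max_le_abs _ _ _).trans ?_
  have h1 : |(|t - 1 - c| - |t - c|)| ≤ 1 := by
    refine (abs_abs_sub_abs_le _ _).trans ?_
    rw [show t - 1 - c - (t - c) = -1 by ring]
    simp
  rw [show 1 - |t - c| / l - (1 - |t - 1 - c| / l) = (|t - 1 - c| - |t - c|) / l by ring, abs_div,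
    abs_of_pos hl]
  gcongr

theorem half_le_tent {c l t : ℝ} (hl : 0 < l) (h : |t - c| ≤ l / 2) : 1 / 2 ≤ tent c l t := by
  refine le_trans ?_ (le_max_right _ _)
  have : |t - c| / l ≤ 1 / 2 := by rw [div_le_iff₀ hl]; linarith
  linarith

/-- If changing a random coordinate into `o` increases `f` on average, then `f` fluctuates. -/
theorem mean_changeSum_le (hp0 : ∀ a, 0 ≤ p a) (hp : ∑ a, p a = 1) (o : A) (f : (ι → A) → ℝ)
    {l : ℝ} (hl : 0 < l) :
    p o * mean p (fun s => tent ((1 - p o) * Fintype.card ι) l (rareCount o s - 1) *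
      changeSum o f s) ≤ (l + Fintype.card ι / l) * mean p (fun s => |f s - mean p f|) := by
  rw [mean_changeSum hp, ← mean_const_mul]
  refine mean_mono hp0 fun s => ?_
  have hpo : p o ≤ 1 := by
    rw [← hp]; exact Finset.single_le_sum (fun a _ => hp0 a) (Finset.mem_univ o)
  set T := rareCount o s
  set c := (1 - p o) * Fintype.card ι with hc
  have h0 : 0 ≤ T := rareCount_nonneg o s
  have h1 : T ≤ Fintype.card ι := rareCount_le o s
  have h2 : |(1 - p o) * (Fintype.card ι - T) * tent c l T - p o * T * tent c l (T - 1)| ≤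
      l + Fintype.card ι / l := by
    -- With `c` the mean of `T`, the first term is small because the tent vanishes beyond distance
    -- `l`, the second because its slope is at most `1 / l`.
    have e : (1 - p o) * (Fintype.card ι - T) * tent c l T - p o * T * tent c l (T - 1) =
        -((T - c) * tent c l T) + p o * T * (tent c l T - tent c l (T - 1)) := by
      rw [hc]; ring
    rw [e]
    refine (abs_add_le _ _).trans (add_le_add ?_ ?_)
    · rw [abs_neg, abs_mul, abs_of_nonneg (tent_nonneg c l T)]
      exact abs_mul_tent_le hl T
    · rw [abs_mul, abs_mul, abs_of_nonneg (hp0 o), abs_of_nonneg h0, div_eq_mul_one_div]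
      refine mul_le_mul ?_ (abs_tent_sub_le hl T) (abs_nonneg _) (by positivity)
      nlinarith [hp0 o]
  calc _ ≤ |f s - mean p f| *
        |(1 - p o) * (Fintype.card ι - T) * tent c l T - p o * T * tent c l (T - 1)| := by
        rw [← abs_mul]; exact le_abs_self _
    _ ≤ |f s - mean p f| * (l + Fintype.card ι / l) := by gcongr
    _ = _ := mul_comm _ _

/-- A lower bound for the fluctuations of `f` when the sum of the changes of `f` is large with
high probability. -/
theorem le_mean_abs_sub (hp0 : ∀ a, 0 ≤ p a) (hp : ∑ a, p a = 1) (o : A) (f : (ι → A) → ℝ)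
    {l c b w : ℝ} (hl : 0 < l) (hc : 0 ≤ c)
    (hS : ∀ s, -(Fintype.card ι : ℝ) ≤ changeSum o f s)
    (hb : mean p (fun s => if changeSum o f s < c then (1 : ℝ) else 0) ≤ b)
    (hw : mean p (fun s : ι → A => if l / 2 < |rareCount o s - 1 - (1 - p o) * Fintype.card ι|
      then (1 : ℝ) else 0) ≤ w) :
    p o * (c / 2 * (1 - b - w) - Fintype.card ι * b) ≤
      (l + Fintype.card ι / l) * mean p (fun s => |f s - mean p f|) := by
  refine le_trans (mul_le_mul_of_nonneg_left ?_ (hp0 o)) (mean_changeSum_le hp0 hp o f hl)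
  -- Off both exceptional events the tent is at least 1/2 and the drift at least `c`; on the event
  -- of small drift the worst case is minus the number of coordinates; elsewhere the integrand is
  -- nonnegative.
  have h1 : mean p (fun s => c / 2 * (1 - (if changeSum o f s < c then (1 : ℝ) else 0) -
      (if l / 2 < |rareCount o s - 1 - (1 - p o) * Fintype.card ι| then (1 : ℝ) else 0)) -
      Fintype.card ι * (if changeSum o f s < c then (1 : ℝ) else 0)) ≤
      mean p (fun s => tent ((1 - p o) * Fintype.card ι) l (rareCount o s - 1) *
      changeSum o f s) := by
    refine mean_mono hp0 fun s => ?_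
    have t0 := tent_nonneg ((1 - p o) * Fintype.card ι) l (rareCount o s - 1)
    have t1 := tent_le_one (c := (1 - p o) * Fintype.card ι) hl (rareCount o s - 1)
    have hn : (0 : ℝ) ≤ Fintype.card ι := Nat.cast_nonneg _
    have hs := hS s
    split_ifs with h2 h3 h3
    · nlinarith
    · nlinarith
    · nlinarith
    · have := half_le_tent hl (not_lt.1 h3)
      nlinarith
  refine le_trans ?_ h1
  rw [mean_sub, mean_const_mul, mean_const_mul, mean_sub, mean_sub, mean_const hp]
  have hn : (0 : ℝ) ≤ Fintype.card ι := Nat.cast_nonneg _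
  have a1 := mul_le_mul_of_nonneg_left hb hn
  have a2 := mul_le_mul_of_nonneg_left (add_le_add hb hw) (div_nonneg hc zero_le_two)
  linarith

end Expectation

/-! ### The longest common subsequence as a function of 2n letters -/

section Pairs

variable {A : Type*}

/-- The length of the longest common subsequence of the two halves of a word. -/
noncomputable def pairLcs {n : ℕ} (s : Fin n ⊕ Fin n → A) : ℝ :=
  lcsLength (fun i => s (Sum.inl i)) (fun i => s (Sum.inr i))

variable [DecidableEq A]

theorem sumFlip_ofFn (o : A) {n : ℕ} (F : List A → ℤ) (x : Fin n → A) :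
    sumFlip o F (List.ofFn x) =
      ∑ i, if x i ≠ o then F (List.ofFn (Function.update x i o)) else 0 := by
  induction n generalizing F with
  | zero => simp [sumFlip]
  | succ n ih =>
    rw [List.ofFn_succ, sumFlip, ih, Fin.sum_univ_succ]
    congr 1
    · rw [List.ofFn_succ]
      simp
    · refine Finset.sum_congr rfl fun i _ => ?_
      rw [List.ofFn_succ, Function.update_of_ne (Fin.succ_ne_zero i).symm]
      congr 4
      ext j
      by_cases h : j = i
      · simp [h]
      · rw [Function.update_of_ne h, Function.update_of_ne (fun h' => h (Fin.succ_injective _ h'))]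

theorem changeSum_pairLcs (o : A) {n : ℕ} (s : Fin n ⊕ Fin n → A) :
    changeSum o pairLcs s = (flipSum o (List.ofFn fun i => s (Sum.inl i))
      (List.ofFn fun i => s (Sum.inr i)) : ℝ) := by
  rw [flipSum, sumFlip_ofFn, sumFlip_ofFn, changeSum, Fintype.sum_sum_type]
  push_cast
  congr 1
  · refine Finset.sum_congr rfl fun i _ => ?_
    have e1 : (fun j => Function.update s (Sum.inl i) o (Sum.inl j)) =
        Function.update (fun j => s (Sum.inl j)) i o := Sum.update_inl_comp_inl
    have e2 : (fun j => Function.update s (Sum.inl i) o (Sum.inr j)) = fun j => s (Sum.inr j) :=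
      Sum.update_inl_comp_inr
    simp only [pairLcs, e1, e2, lcsLength_eq_listLcs]
  · refine Finset.sum_congr rfl fun i _ => ?_
    have e1 : (fun j => Function.update s (Sum.inr i) o (Sum.inr j)) =
        Function.update (fun j => s (Sum.inr j)) i o := Sum.update_inr_comp_inr
    have e2 : (fun j => Function.update s (Sum.inr i) o (Sum.inl j)) = fun j => s (Sum.inl j) :=
      Sum.update_inr_comp_inl
    simp only [pairLcs, e1, e2, lcsLength_eq_listLcs]

theorem neg_le_flipSum (o : A) (x y : List A) : -(2 * x.length : ℤ) ≤ flipSum o x y := by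
  obtain ⟨L, f, hL, rfl, rfl, hs, -, -⟩ := exists_unsplittable_alignment o x y
  have h1 := gain₁_le_sumFlip o L f
  have h2 := gain₂_le_sumFlip o L f
  have h3 := length_le_word₁ L f.1
  rw [hs] at h1 h2
  rw [flipSum]
  omega

theorem count_ofFn (o : A) {n : ℕ} (x : Fin n → A) :
    ((List.ofFn x).count o : ℝ) = n - rareCount o x := by
  have h1 : ((List.ofFn x).count o : ℝ) = ∑ i, if x i = o then (1 : ℝ) else 0 := by
    induction n with
    | zero => simp
    | succ n ih =>
      rw [List.ofFn_succ, List.count_cons, Fin.sum_univ_succ, ← ih]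
      push_cast
      by_cases h : x 0 = o <;> simp [h, add_comm]
  have h2 : (n : ℝ) = ∑ i : Fin n, (1 : ℝ) := by simp
  rw [h1, rareCount, h2, ← Finset.sum_sub_distrib]
  refine Finset.sum_congr rfl fun i _ => ?_
  by_cases h : x i = o <;> simp [h]

end Pairs

theorem lcsLength_const {A : Type*} (o : A) {n : ℕ} :
    lcsLength (fun _ : Fin n => o) (fun _ => o) = n := by
  refine le_antisymm ?_ ((isGreatest_lcsLength _ _).2 ⟨id, id, strictMono_id, strictMono_id,
    fun _ => rfl⟩)
  obtain ⟨i, -, hi, -, -⟩ := (isGreatest_lcsLength (fun _ : Fin n => o) (fun _ => o)).1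
  simpa using Fintype.card_le_of_injective i hi.injective

/-! ### Probability of the exceptional events and the mean absolute deviation -/

namespace DominantLetter

variable {A : Type*} [Fintype A] [DecidableEq A] {p : A → ℝ} {o : A} {q : ℝ}

/-- The indicator function of the letters different from `o` has mean `1 - p o`. -/
theorem sum_centered (h : DominantLetter p o q) :
    ∑ a, p a * ((if a ≠ o then 1 else 0) - (1 - p o)) = 0 := by
  have h1 : ∑ a, p a * (if a ≠ o then (1 : ℝ) else 0) = 1 - p o := by
    have h0 := h.sum_eq
    rw [← Finset.add_sum_erase _ p (Finset.mem_univ o)] at h0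
    rw [← Finset.add_sum_erase _ _ (Finset.mem_univ o), Finset.sum_congr rfl
      (g := p) (fun a ha => by rw [if_pos (Finset.ne_of_mem_erase ha), mul_one])]
    simp only [ne_eq, not_true_eq_false, if_false, mul_zero]
    linarith
  simp only [mul_sub, Finset.sum_sub_distrib, h1, ← Finset.sum_mul, h.sum_eq]
  ring

theorem sum_centered_sq (h : DominantLetter p o q) :
    ∑ a, p a * ((if a ≠ o then 1 else 0) - (1 - p o)) ^ 2 ≤ 1 / 1000 := by
  have h1 : ∀ a, p a * ((if a ≠ o then (1 : ℝ) else 0) - (1 - p o)) ^ 2 =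
      p a * ((if a ≠ o then 1 else 0) - (1 - p o)) * (1 - 2 * (1 - p o)) +
        p a * ((1 - p o) * p o) := by
    intro a
    split_ifs <;> ring
  simp only [h1, Finset.sum_add_distrib, ← Finset.sum_mul, h.sum_centered, h.sum_eq]
  have := h.large
  nlinarith [h.q_le_eps, h.q_pos]

/-- Chebyshev's inequality for signed numbers of letters different from `o`. -/
theorem mean_deviation_le (h : DominantLetter p o q) {ι : Type*} [Fintype ι]
    [DecidableEq ι] (c : ι → ℝ) (hc : ∀ i, c i ^ 2 = 1) {b : ℝ} (hb : 0 < b) :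
    mean p (fun s : ι → A => if b < |∑ i, c i * ((if s i ≠ o then 1 else 0) - (1 - p o))|
      then (1 : ℝ) else 0) ≤ Fintype.card ι / 1000 / b ^ 2 := by
  refine (mean_indicator_le h.nonneg _ hb).trans ?_
  rw [mean_sq_sum h.sum_eq (fun a => (if a ≠ o then 1 else 0) - (1 - p o)) h.sum_centered]
  simp only [hc]
  have := h.sum_centered_sq
  gcongr
  simp only [Finset.sum_const, Finset.card_univ, nsmul_eq_mul, mul_one]
  rw [div_eq_mul_one_div]
  gcongr

/-- Chebyshev's inequality at distance √n; the shift by 1 is absorbed by the second √n of the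
half-width 2√n. -/
theorem mean_window_le (h : DominantLetter p o q) {n : ℕ} (hn : 1 ≤ n) :
    mean p (fun s : Fin n ⊕ Fin n → A => if 4 * √n / 2 <
      |rareCount o s - 1 - (1 - p o) * Fintype.card (Fin n ⊕ Fin n)| then (1 : ℝ) else 0) ≤
      1 / 4 := by
  have hn' : (1 : ℝ) ≤ n := by exact_mod_cast hn
  have h1 : 1 ≤ √(n : ℝ) := Real.one_le_sqrt.2 hn'
  have h2 := h.mean_deviation_le (ι := Fin n ⊕ Fin n) (fun _ => 1) (by simp) (b := √n)
    (by linarith)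
  rw [Real.sq_sqrt (by linarith)] at h2
  refine le_trans (mean_mono h.nonneg fun s => ?_) (h2.trans ?_)
  · have e : ∑ i, (1 : ℝ) * ((if s i ≠ o then 1 else 0) - (1 - p o)) =
        rareCount o s - (1 - p o) * Fintype.card (Fin n ⊕ Fin n) := by
      simp only [one_mul, Finset.sum_sub_distrib, rareCount, Finset.sum_const, Finset.card_univ,
        nsmul_eq_mul]
      ring
    rw [e]
    split_ifs with h3 h4 h4
    · exact le_rfl
    · exfalso
      have := abs_sub (rareCount o s - (1 - p o) * Fintype.card (Fin n ⊕ Fin n)) 1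
      rw [abs_one, show rareCount o s - (1 - p o) * Fintype.card (Fin n ⊕ Fin n) - 1 =
        rareCount o s - 1 - (1 - p o) * Fintype.card (Fin n ⊕ Fin n) by ring] at this
      linarith
    · norm_num
    · exact le_rfl
  · rw [div_le_iff₀ (by linarith)]
    simp only [Fintype.card_sum, Fintype.card_fin]
    push_cast
    linarith

theorem mean_imbalance_le (h : DominantLetter p o q) {n : ℕ} {b : ℝ} (hb : 0 < b) :
    mean p (fun s : Fin n ⊕ Fin n → A => if b <
      |((List.ofFn fun i => s (Sum.inl i)).count o : ℝ) -
        (List.ofFn fun i => s (Sum.inr i)).count o| then (1 : ℝ) else 0) ≤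
      2 * n / 1000 / b ^ 2 := by
  have h2 := h.mean_deviation_le (ι := Fin n ⊕ Fin n) (Sum.elim (fun _ => 1) (fun _ => -1))
    (by rintro (i | i) <;> simp) hb
  simp only [Fintype.card_sum, Fintype.card_fin] at h2
  refine le_trans (le_of_eq ?_) (h2.trans (le_of_eq ?_))
  · congr 1
    ext s
    have e : ∑ i, (Sum.elim (fun _ => 1) (fun _ => -1) : Fin n ⊕ Fin n → ℝ) i *
        ((if s i ≠ o then 1 else 0) - (1 - p o)) =
        ((List.ofFn fun i => s (Sum.inr i)).count o : ℝ) -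
          (List.ofFn fun i => s (Sum.inl i)).count o := by
      rw [count_ofFn, count_ofFn, Fintype.sum_sum_type]
      simp only [Sum.elim_inl, Sum.elim_inr, one_mul, neg_mul, Finset.sum_neg_distrib,
        Finset.sum_sub_distrib, rareCount]
      ring
    rw [e, abs_sub_comm]
  · push_cast; ring

/-- Small drift means either an imbalance above θn, controlled by Chebyshev's inequality, or a pair
counted by `sum_flipSum_le`. The exponential bound on the latter is weakened to order 1/n, which
suffices. -/
theorem mean_bad_le (h : DominantLetter p o q) {n : ℕ} (hn : 1 ≤ n) :
    mean p (fun s : Fin n ⊕ Fin n → A =>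
      if changeSum o pairLcs s < q ^ 2 / 1000 * n then (1 : ℝ) else 0) ≤ 30000 / (q ^ 4 * n) := by
  classical
  have hq := h.q_pos
  have hn' : (0 : ℝ) < n := by exact_mod_cast hn
  set θ := q ^ 2 / 1000 with hθ
  have hθ0 : 0 < θ := by positivity
  set E := ⌊2 * θ * n⌋₊ with hE
  have hE1 : (E : ℝ) ≤ 2 * θ * n := Nat.floor_le (by positivity)
  set B : Finset ((Fin n → A) × (Fin n → A)) := Finset.univ.filter fun d =>
    flipSum o (List.ofFn d.1) (List.ofFn d.2) +
      |((List.ofFn d.1).count o : ℤ) - (List.ofFn d.2).count o| ≤ E with hB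
  have h1 := h.sum_flipSum_le B E (fun d hd => (Finset.mem_filter.1 hd).2)
  have h2 : ((21 : ℝ) / 20) ^ E ≤ (1 + θ) ^ n := by
    have hθ1 : 2 * θ ≤ 1 := by have := h.q_le; rw [hθ]; nlinarith
    calc ((21 : ℝ) / 20) ^ E = ((21 : ℝ) / 20) ^ (E : ℝ) := (Real.rpow_natCast _ _).symm
      _ ≤ ((21 : ℝ) / 20) ^ (2 * θ * n) :=
        Real.rpow_le_rpow_of_exponent_le (by norm_num) hE1
      _ = (((21 : ℝ) / 20) ^ (2 * θ)) ^ n := by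
        rw [Real.rpow_mul (by norm_num), Real.rpow_natCast]
      _ ≤ (1 + θ) ^ n := by
        gcongr
        -- Bernoulli's inequality with exponent 2θ ≤ 1: the error term uses up at most half of the
        -- available power (1 + θ)^(2n).
        have := rpow_one_add_le_one_add_mul_self (s := 1 / 20) (p := 2 * θ) (by norm_num)
          (by positivity) hθ1
        rw [show (1 : ℝ) + 1 / 20 = 21 / 20 by norm_num] at this
        linarith
  have h3 : 1 + n * θ ≤ (1 + θ) ^ n := one_add_mul_le_pow (by linarith) n
  have h4 : ∑ d ∈ B, (∏ i, p (d.1 i)) * ∏ i, p (d.2 i) ≤ 20000 / (q ^ 4 * n) := by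
    set b := ∑ d ∈ B, (∏ i, p (d.1 i)) * ∏ i, p (d.2 i)
    have hb : 0 ≤ b := Finset.sum_nonneg fun d _ => mul_nonneg
      (Finset.prod_nonneg fun i _ => h.nonneg _) (Finset.prod_nonneg fun i _ => h.nonneg _)
    have hz : 0 < (1 + θ) ^ n := by positivity
    have h5 : b * (1 + θ) ^ n ≤ 20 / q ^ 2 := by
      have : b * (1 + θ) ^ n * (1 + θ) ^ n ≤ 20 / q ^ 2 * (1 + θ) ^ n := by
        calc _ = b * (1 + θ) ^ (2 * n) := by ring
          _ ≤ _ := h1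
          _ ≤ (1 + θ) ^ n * (20 / q ^ 2) := by gcongr
          _ = _ := mul_comm _ _
      exact le_of_mul_le_mul_right this hz
    have h6 : b * (n * θ) ≤ 20 / q ^ 2 := by
      refine le_trans ?_ h5
      gcongr
      linarith
    rw [le_div_iff₀ (by positivity)]
    rw [le_div_iff₀ (by positivity), hθ] at h6
    nlinarith
  have h5 := h.mean_imbalance_le (n := n) (b := θ * n) (by positivity)
  have h6 : 2 * (n : ℝ) / 1000 / (θ * n) ^ 2 = 2000 / (q ^ 4 * n) := by
    rw [hθ]; field_simp; norm_num
  have h7 : mean p (fun s : Fin n ⊕ Fin n → A =>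
      if ((fun i => s (Sum.inl i)), (fun i => s (Sum.inr i))) ∈ B then (1 : ℝ) else 0) =
      ∑ d ∈ B, (∏ i, p (d.1 i)) * ∏ i, p (d.2 i) := by
    rw [mean, ← (Equiv.sumArrowEquivProdArrow (Fin n) (Fin n) A).symm.sum_comp,
      ← Finset.sum_filter_add_sum_filter_not Finset.univ (fun d => d ∈ B)]
    simp only [Fintype.prod_sum_type, Equiv.sumArrowEquivProdArrow, Equiv.coe_fn_symm_mk,
      Sum.elim_inl, Sum.elim_inr, Prod.mk.eta]
    rw [Finset.sum_congr rfl (g := fun d : (Fin n → A) × (Fin n → A) =>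
        (∏ i, p (d.1 i)) * ∏ i, p (d.2 i)) (fun d hd => by
          rw [if_pos (Finset.mem_filter.1 hd).2, mul_one]),
      Finset.sum_eq_zero (s := Finset.univ.filter fun d => ¬ d ∈ B) (fun d hd => by
          rw [if_neg (Finset.mem_filter.1 hd).2, mul_zero]), add_zero]
    congr 1
    ext d
    simp
  have h8 : 30000 / (q ^ 4 * n) = 20000 / (q ^ 4 * n) + 10000 / (q ^ 4 * n) := by ring
  have h9 : 2000 / (q ^ 4 * n) ≤ 10000 / (q ^ 4 * n) := by gcongr; norm_num
  rw [h8]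
  refine le_trans ?_ (add_le_add (h7.le.trans h4) (h5.trans (h6.le.trans h9)))
  rw [← mean_add]
  refine mean_mono h.nonneg fun s => ?_
  have hnn : ∀ c : Prop, ∀ _ : Decidable c, (0 : ℝ) ≤ if c then 1 else 0 := by
    intro c _; split_ifs <;> norm_num
  by_cases hs : changeSum o pairLcs s < θ * n
  · rw [if_pos hs]
    by_cases hi : θ * n < |((List.ofFn fun i => s (Sum.inl i)).count o : ℝ) -
        (List.ofFn fun i => s (Sum.inr i)).count o|
    · rw [if_pos hi]
      have := hnn (((fun i => s (Sum.inl i)), (fun i => s (Sum.inr i))) ∈ B) inferInstance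
      linarith
    · have hm : ((fun i => s (Sum.inl i)), (fun i => s (Sum.inr i))) ∈ B := by
        rw [hB, Finset.mem_filter]
        refine ⟨Finset.mem_univ _, ?_⟩
        dsimp only
        rw [changeSum_pairLcs] at hs
        have e : ((flipSum o (List.ofFn fun i => s (Sum.inl i)) (List.ofFn fun i => s (Sum.inr i)) +
          |((List.ofFn fun i => s (Sum.inl i)).count o : ℤ) -
            (List.ofFn fun i => s (Sum.inr i)).count o| : ℤ) : ℝ) < 2 * θ * n := by
          push_cast
          linarith
        have e' := e.trans (Nat.lt_floor_add_one (2 * θ * n))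
        rw [← hE] at e'
        have e'' : flipSum o (List.ofFn fun i => s (Sum.inl i))
          (List.ofFn fun i => s (Sum.inr i)) + |((List.ofFn fun i => s (Sum.inl i)).count o : ℤ) -
            (List.ofFn fun i => s (Sum.inr i)).count o| < (E : ℤ) + 1 := by exact_mod_cast e'
        omega
      rw [if_pos hm, if_neg hi, add_zero]
  · rw [if_neg hs]
    exact add_nonneg (hnn _ _) (hnn _ _)

/-- The mean absolute deviation of the longest common subsequence of long words. -/
theorem le_mean_abs_sub_of_large (h : DominantLetter p o q) {n : ℕ} (hn : 1000000000 / q ^ 6 ≤ n) :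
    q ^ 2 / 40000 * √n ≤
      mean p (fun s : Fin n ⊕ Fin n → A => |pairLcs s - mean p (pairLcs (n := n))|) := by
  have hq := h.q_pos
  have hq1 := h.q_le
  have hn0 : (0 : ℝ) < n := lt_of_lt_of_le (by positivity) hn
  have hn1 : 1 ≤ n := by exact_mod_cast Nat.cast_pos.1 hn0
  have hS : ∀ s : Fin n ⊕ Fin n → A, -(Fintype.card (Fin n ⊕ Fin n) : ℝ) ≤
      changeSum o pairLcs s := by
    intro s
    rw [changeSum_pairLcs]
    have := neg_le_flipSum o (List.ofFn fun i => s (Sum.inl i)) (List.ofFn fun i => s (Sum.inr i))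
    simp only [List.length_ofFn] at this
    have h' : (-(2 * n : ℤ) : ℝ) ≤ flipSum o (List.ofFn fun i => s (Sum.inl i))
      (List.ofFn fun i => s (Sum.inr i)) := by exact_mod_cast this
    simp only [Fintype.card_sum, Fintype.card_fin]
    push_cast at h' ⊢
    linarith
  have hsq : 0 < √(n : ℝ) := Real.sqrt_pos.2 hn0
  have hss : √(n : ℝ) * √n = n := Real.mul_self_sqrt hn0.le
  have h1 := le_mean_abs_sub h.nonneg h.sum_eq o pairLcs (l := 4 * √n) (c := q ^ 2 / 1000 * n)
    (by positivity) (by positivity) hS (h.mean_bad_le hn1) (h.mean_window_le hn1)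
  set b := 30000 / (q ^ 4 * n) with hb
  set D := mean p (fun s : Fin n ⊕ Fin n → A => |pairLcs s - mean p (pairLcs (n := n))|)
  have hb0 : 0 ≤ b := by positivity
  -- The threshold on `n` is what makes the loss on bad words, at most 2n`b`, a fraction of the gain
  -- of order q²n.
  have hb1 : b ≤ q ^ 2 / 16000 := by
    rw [hb, div_le_iff₀ (by positivity)]
    rw [div_le_iff₀ (by positivity)] at hn
    nlinarith
  simp only [Fintype.card_sum, Fintype.card_fin] at h1
  push_cast at h1
  have h2 : ((n : ℝ) + n) / (4 * √n) = √n / 2 := by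
    rw [div_eq_iff (by positivity)]
    linarith
  rw [h2] at h1
  have h3 : q ^ 2 / 1000 * n / 8 ≤ q ^ 2 / 1000 * n / 2 * (1 - b - 1 / 4) - (n + n) * b := by
    have hb2 : b ≤ 1 / 4 := by nlinarith
    have a1 : (n + n) * b ≤ (n + n) * (q ^ 2 / 16000) := by gcongr
    have a2 : q ^ 2 / 1000 * n / 2 * (1 / 2) ≤ q ^ 2 / 1000 * n / 2 * (1 - b - 1 / 4) := by
      gcongr; linarith
    linarith
  have h4 : 999 / 1000 * (q ^ 2 / 1000 * n / 8) ≤ (4 * √n + √n / 2) * D :=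
    le_trans (mul_le_mul h.large h3 (by positivity) (by linarith [h.large])) h1
  have h5 : √(n : ℝ) * (q ^ 2 / 40000 * √n) ≤ √n * D := by
    have e : √(n : ℝ) * (q ^ 2 / 40000 * √n) = q ^ 2 / 40000 * n := by
      linear_combination q ^ 2 / 40000 * hss
    have : 0 < q ^ 2 * n := by positivity
    rw [e]
    linarith
  exact le_of_mul_le_mul_left h5 hsq

/-- Two explicit configurations, with values n and 0, each have probability at least `q ^ (2 * n)`,
and the distances of these values from any number add up to at least n. This serves for the finitely
many small n. -/
theorem le_mean_abs_sub_of_pos (h : DominantLetter p o q) {n : ℕ} (hn : 1 ≤ n) :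
    q ^ (2 * n) * n ≤
      mean p (fun s : Fin n ⊕ Fin n → A => |pairLcs s - mean p (pairLcs (n := n))|) := by
  have hq := h.q_pos
  have hqo : q ≤ p o := by linarith [h.q_le, h.large]
  obtain ⟨a, ha, hpa⟩ := h.exists_eq
  have hmem : ∀ b c : A, q ≤ p b → q ≤ p c →
      q ^ (2 * n) ≤ ∏ i, p (Sum.elim (fun _ : Fin n => b) (fun _ : Fin n => c) i) := by
    intro b c hb hc
    rw [Fintype.prod_sum_type]
    simp only [Sum.elim_inl, Sum.elim_inr, Finset.prod_const, Finset.card_univ, Fintype.card_fin]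
    rw [two_mul, pow_add]
    have := h.nonneg b
    gcongr
  set s₁ : Fin n ⊕ Fin n → A := Sum.elim (fun _ => o) (fun _ => o)
  set s₂ : Fin n ⊕ Fin n → A := Sum.elim (fun _ => o) (fun _ => a)
  have hne : s₁ ≠ s₂ := by
    intro he
    have := congrFun he (Sum.inr ⟨0, hn⟩)
    exact ha (by simpa [s₁, s₂] using this.symm)
  have f1 : pairLcs s₁ = n := by
    simp only [pairLcs, s₁, Sum.elim_inl, Sum.elim_inr]
    exact_mod_cast lcsLength_const o
  have f2 : pairLcs s₂ = 0 := by
    simp only [pairLcs, s₂, Sum.elim_inl, Sum.elim_inr]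
    obtain ⟨i, j, -, -, hij⟩ := (isGreatest_lcsLength (fun _ : Fin n => o) (fun _ => a)).1
    by_contra h0
    exact ha (hij ⟨0, Nat.pos_of_ne_zero fun h' => h0 (by simp [h'])⟩).symm
  set M := mean p (pairLcs (n := n))
  have hsum : ∑ s ∈ ({s₁, s₂} : Finset (Fin n ⊕ Fin n → A)), (∏ i, p (s i)) * |pairLcs s - M| ≤
      mean p (fun s : Fin n ⊕ Fin n → A => |pairLcs s - M|) :=
    Finset.sum_le_sum_of_subset_of_nonneg (Finset.subset_univ _) fun s _ _ =>
      mul_nonneg (Finset.prod_nonneg fun i _ => h.nonneg _) (abs_nonneg _)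
  refine le_trans ?_ hsum
  rw [Finset.sum_pair hne, f1, f2]
  have e1 := mul_le_mul_of_nonneg_right (hmem o o hqo hqo) (abs_nonneg ((n : ℝ) - M))
  have e2 := mul_le_mul_of_nonneg_right (hmem o a hqo hpa.ge) (abs_nonneg (0 - M))
  have e3 : (n : ℝ) ≤ |(n : ℝ) - M| + |0 - M| := by
    have := abs_sub ((n : ℝ) - M) (0 - M)
    rw [show (n : ℝ) - M - (0 - M) = n by ring, abs_of_nonneg (Nat.cast_nonneg n)] at this
    exact this
  have e4 := mul_le_mul_of_nonneg_left e3 (by positivity : 0 ≤ q ^ (2 * n))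
  linarith

end DominantLetter

/-- A lower bound for the mean absolute deviation depending only on `q`. -/
theorem exists_le_mean_abs_sub {q : ℝ} (hq : 0 < q) :
    ∃ c : ℝ, 0 < c ∧ ∀ (m : ℕ) (p : Fin m → ℝ) (o : Fin m), DominantLetter p o q →
      ∀ n : ℕ, 1 ≤ n → c * √n ≤
        mean p (fun s : Fin n ⊕ Fin n → Fin m => |pairLcs s - mean p (pairLcs (n := n))|) := by
  obtain ⟨N, hN⟩ := exists_nat_ge (1000000000 / q ^ 6)
  refine ⟨min (q ^ 2 / 40000) (q ^ (2 * N)), by positivity, fun m p o h n hn => ?_⟩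
  by_cases hle : N ≤ n
  · refine le_trans ?_ (h.le_mean_abs_sub_of_large (hN.trans (Nat.cast_le.2 hle)))
    gcongr
    exact min_le_left _ _
  · refine le_trans ?_ (h.le_mean_abs_sub_of_pos hn)
    have h1 : √(n : ℝ) ≤ n := by
      have hn' : (1 : ℝ) ≤ n := by exact_mod_cast hn
      exact Real.sqrt_le_iff.2 ⟨by linarith, by nlinarith⟩
    have h2 : q ^ (2 * N) ≤ q ^ (2 * n) :=
      pow_le_pow_of_le_one hq.le (by linarith [h.q_le]) (by omega)
    exact mul_le_mul ((min_le_right _ _).trans h2) h1 (Real.sqrt_nonneg _) (by positivity)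

open MeasureTheory ProbabilityTheory

/-! ### From the probability space to finite sums -/

section Transfer

variable {Ω : Type*} [MeasurableSpace Ω] {μ : Measure Ω} {m : ℕ} {p : Fin m → ℝ}
  {X Y : ℕ → Ω → Fin m}

/-- The first `n` letters of both sequences. -/
def pairWord (X Y : ℕ → Ω → Fin m) (n : ℕ) (ω : Ω) : Fin n ⊕ Fin n → Fin m :=
  Sum.elim (fun i => X i ω) (fun i => Y i ω)

theorem IsIIDPair.measurable_pairWord (h : IsIIDPair μ p X Y) (n : ℕ) :
    Measurable (pairWord X Y n) := by
  rw [measurable_pi_iff]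
  rintro (i | i)
  · exact h.measurable_X i
  · exact h.measurable_Y i

theorem measureReal_letters {X : ℕ → Ω → Fin m} (hX : iIndepFun X μ)
    (hp : ∀ i k, μ.real (X i ⁻¹' {k}) = p k) {n : ℕ} (x : Fin n → Fin m) :
    μ.real (⋂ i : Fin n, X i ⁻¹' {x i}) = ∏ i, p (x i) := by
  have h1 := (hX.precomp (g := fun i : Fin n => (i : ℕ)) Fin.val_injective)
    |>.measure_inter_preimage_eq_mul Finset.univ (sets := fun i => {x i})
      (fun i _ => measurableSet_singleton _)
  simp only [Finset.mem_univ, Set.iInter_true] at h1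
  rw [measureReal_def, h1, ENNReal.toReal_prod]
  exact Finset.prod_congr rfl fun i _ => hp i (x i)

theorem IsIIDPair.measureReal_pairWord (h : IsIIDPair μ p X Y) {n : ℕ}
    (s : Fin n ⊕ Fin n → Fin m) : μ.real (pairWord X Y n ⁻¹' {s}) = ∏ i, p (s i) := by
  have h1 := h.indep_XY.measure_inter_preimage_eq_mul
    (⋂ i : Fin n, {f : ℕ → Fin m | f i = s (Sum.inl i)})
    (⋂ i : Fin n, {f : ℕ → Fin m | f i = s (Sum.inr i)})
    (MeasurableSet.iInter fun i => measurable_pi_apply (i : ℕ) (measurableSet_singleton _))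
    (MeasurableSet.iInter fun i => measurable_pi_apply (i : ℕ) (measurableSet_singleton _))
  simp only [Set.preimage_iInter] at h1
  have e : pairWord X Y n ⁻¹' {s} =
      (⋂ i : Fin n, X i ⁻¹' {s (Sum.inl i)}) ∩ ⋂ i : Fin n, Y i ⁻¹' {s (Sum.inr i)} := by
    ext ω
    simp only [pairWord, Set.mem_preimage, Set.mem_singleton_iff, Set.mem_inter_iff,
      Set.mem_iInter, funext_iff, Sum.forall, Sum.elim_inl, Sum.elim_inr]
  rw [Fintype.prod_sum_type, ← measureReal_letters h.indep_X h.law_X,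
    ← measureReal_letters h.indep_Y h.law_Y, e, measureReal_def, measureReal_def, measureReal_def,
    ← ENNReal.toReal_mul]
  exact congrArg ENNReal.toReal h1

theorem IsIIDPair.integral_pairWord [IsProbabilityMeasure μ] (h : IsIIDPair μ p X Y) {n : ℕ}
    (G : (Fin n ⊕ Fin n → Fin m) → ℝ) :
    ∫ ω, G (pairWord X Y n ω) ∂μ = mean p G := by
  have hZ := h.measurable_pairWord n
  have : IsProbabilityMeasure (μ.map (pairWord X Y n)) :=
    Measure.isProbabilityMeasure_map hZ.aemeasurable
  rw [← integral_map (φ := pairWord X Y n) hZ.aemeasurable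
    (Measurable.of_discrete.aestronglyMeasurable), integral_fintype (Integrable.of_finite), mean]
  refine Finset.sum_congr rfl fun s _ => ?_
  rw [map_measureReal_apply hZ (measurableSet_singleton s), h.measureReal_pairWord, smul_eq_mul]

theorem IsIIDPair.absCentralMoment_eq [IsProbabilityMeasure μ] (h : IsIIDPair μ p X Y) (n : ℕ)
    (r : ℝ) : absCentralMoment μ (LC X Y n) r =
      mean p (fun s : Fin n ⊕ Fin n → Fin m =>
        |pairLcs s - mean p (pairLcs (n := n))| ^ r) := by
  have h1 : ∀ ω, LC X Y n ω = pairLcs (pairWord X Y n ω) := fun ω => rfl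
  simp only [absCentralMoment, h1]
  rw [h.integral_pairWord pairLcs]
  exact h.integral_pairWord (fun s => |pairLcs s - mean p (pairLcs (n := n))| ^ r)

theorem IsIIDPair.nonneg (h : IsIIDPair μ p X Y) (k : Fin m) : 0 ≤ p k := by
  rw [← h.law_X 0 k]
  exact measureReal_nonneg

theorem IsIIDPair.sum_eq_one [IsProbabilityMeasure μ] (h : IsIIDPair μ p X Y) :
    ∑ k, p k = 1 := by
  have h1 : ∑ k, μ.real (X 0 ⁻¹' {k}) = μ.real (X 0 ⁻¹' ↑(Finset.univ : Finset (Fin m))) :=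
    sum_measureReal_preimage_singleton Finset.univ
      fun k _ => h.measurable_X 0 (measurableSet_singleton k)
  simpa [h.law_X] using h1

end Transfer

/-- Jensen's inequality. -/
theorem mean_rpow_le {ι A : Type*} [Fintype ι] [DecidableEq ι] [Fintype A] {p : A → ℝ}
    (hp0 : ∀ a, 0 ≤ p a) (hp : ∑ a, p a = 1) (F : (ι → A) → ℝ) (hF : ∀ s, 0 ≤ F s) {r : ℝ}
    (hr : 1 ≤ r) : mean p F ^ r ≤ mean p (fun s => F s ^ r) := by
  refine Real.rpow_arith_mean_le_arith_mean_rpow Finset.univ (fun s : ι → A => ∏ i, p (s i)) F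
    (fun s _ => Finset.prod_nonneg fun i _ => hp0 _) ?_ (fun s _ => hF s) hr
  simpa [mean] using mean_const (ι := ι) hp 1

theorem K_le_inv_two_pow (m : ℕ) : K m ≤ 1 / 2 ^ 67 := by
  have h1 : (2 : ℝ) ^ 67 ≤ Real.exp 67 := by
    have := Real.add_one_le_exp (1 : ℝ)
    calc (2 : ℝ) ^ 67 ≤ Real.exp 1 ^ 67 := by gcongr; linarith
      _ = Real.exp 67 := by rw [← Real.exp_nat_mul]; norm_num
  calc K m ≤ (2 : ℝ)⁻¹ ^ 4 * (10 : ℝ)⁻¹ ^ 2 * Real.exp (-67) := min_le_left _ _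
    _ ≤ 1 * Real.exp (-67) := by gcongr; norm_num
    _ = 1 / Real.exp 67 := by rw [Real.exp_neg]; ring
    _ ≤ 1 / 2 ^ 67 := by gcongr

/-- The bound on q gives m q ≤ 10⁻⁶, so all rare letters together have probability at most 10⁻⁶. -/
theorem dominantLetter_of_isIIDPair {Ω : Type*} [MeasurableSpace Ω] {μ : Measure Ω}
    [IsProbabilityMeasure μ] {m : ℕ} {p : Fin m → ℝ} {X Y : ℕ → Ω → Fin m}
    (h : IsIIDPair μ p X Y) {q : ℝ} (hq0 : 0 < q) (hq : q ≤ K m / (2 * (m : ℝ) ^ 2)) {o : Fin m}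
    (hg : IsGreatest (p '' {j | j ≠ o}) q) : DominantLetter p o q := by
  have hm : (1 : ℝ) ≤ m := by exact_mod_cast Fin.pos o
  have hK := K_le_inv_two_pow m
  have hmq : m * q ≤ 1 / 1000000 := by
    rw [le_div_iff₀ (by positivity)] at hq
    have : m * q ≤ q * (2 * (m : ℝ) ^ 2) := by
      rw [mul_comm]
      gcongr
      nlinarith
    exact (this.trans (hq.trans hK)).trans (by norm_num)
  have hle : ∀ a, a ≠ o → p a ≤ q := fun a ha => hg.2 ⟨a, ha, rfl⟩
  refine ⟨h.nonneg, h.sum_eq_one, hq0, by nlinarith, hle, ?_, ?_⟩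
  · obtain ⟨a, ha, hpa⟩ := hg.1
    exact ⟨a, ha, hpa⟩
  · have h1 := h.sum_eq_one
    rw [← Finset.add_sum_erase _ p (Finset.mem_univ o)] at h1
    have h2 : ∑ a ∈ Finset.univ.erase o, p a ≤ m * q := by
      calc _ ≤ ∑ a ∈ Finset.univ.erase o, q :=
            Finset.sum_le_sum fun a ha => hle a (Finset.ne_of_mem_erase ha)
        _ ≤ ∑ a : Fin m, q := Finset.sum_le_sum_of_subset_of_nonneg (Finset.subset_univ _)
            fun _ _ _ => hq0.le
        _ = m * q := by simp
    linarith

end LCS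

theorem theorem1 (r : ℝ) (hr : 1 ≤ r) (m : ℕ) (pmax q : ℝ)
    (hpmax : 1 / 2 < pmax) (hq0 : 0 < q)
    (hq : q ≤ min ((2 : ℝ)⁻¹ ^ 2 * Real.exp (-5) * LCS.K m / (m : ℝ))
      (LCS.K m / (2 * (m : ℝ) ^ 2))) :
    ∃ C : ℝ, 0 < C ∧
      ∀ (p : Fin m → ℝ) (j₀ : Fin m), p j₀ = pmax → IsGreatest (p '' {j | j ≠ j₀}) q →
      ∀ (Ω : Type*) [MeasurableSpace Ω] (μ : MeasureTheory.Measure Ω)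
        [MeasureTheory.IsProbabilityMeasure μ] (X Y : ℕ → Ω → Fin m),
        LCS.IsIIDPair μ p X Y →
        ∀ n : ℕ, 1 ≤ n →
          C * (n : ℝ) ^ (r / 2) ≤ LCS.absCentralMoment μ (LCS.LC X Y n) r := by
  obtain ⟨c, hc, hmain⟩ := LCS.exists_le_mean_abs_sub hq0
  refine ⟨c ^ r, Real.rpow_pos_of_pos hc r, ?_⟩
  intro p j₀ _ hg Ω _ μ _ X Y h n hn
  have hd := LCS.dominantLetter_of_isIIDPair h hq0 (hq.trans (min_le_right _ _)) hg
  rw [h.absCentralMoment_eq]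
  refine le_trans ?_ (LCS.mean_rpow_le hd.nonneg hd.sum_eq _ (fun s => abs_nonneg _) hr)
  -- After Jensen's inequality, what remains is the r-th power of the bound on the mean absolute
  -- deviation.
  have e : c ^ r * (n : ℝ) ^ (r / 2) = (c * √n) ^ r := by
    rw [Real.mul_rpow hc.le (Real.sqrt_nonneg _), Real.sqrt_eq_rpow,
      ← Real.rpow_mul (Nat.cast_nonneg n)]
    ring_nf
  rw [e]
  exact Real.rpow_le_rpow (by positivity) (hmain m p j₀ hd n hn) (by linarith)
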